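/- The Erdős–Moser principle $\mathsf{EM}$ ("every tournament on $\omega$ has an infinite transitive set") admits preservation of $\Delta^0_2$-definitions. Explicitly: a tournament is a relation $R\subseteq\omega\times\omega$ induced by a colouring $c$ of the two-element subsets of $\omega$ with colours $0,1$, i.e. for $x<y$ one has $x\,R\,y$ if and only if $c(\{x,y\})=1$ and $y\,R\,x$ if and only if $c(\{x,y\})=0$, and $x\,R\,x$ for no $x$. A set $Y\subseteq\omega$ is transitive for $R$ if $R\cap Y^2$ is a transitive relation. For $W\subseteq\omega$, a set $A\subseteq\omega$ is properly $\Delta^0_2$ relative to $W$ if $A$ is $\Delta^0_2$ relative to $W$ but neither $\Sigma^0_1$ nor $\Pi^0_1$ relative to $W$. Then for every $Z\subseteq\omega$ and every tournament $R\le_T Z$ there is an infinite set $Y\subseteq\omega$, transitive for $R$, such that every set $A\subseteq\omega$ that is properly $\Delta^0_2$ relative to $Z$ is properly $\Delta^0_2$ relative to $Z\oplus Y$. -/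

import Mathlib

namespace DefStrength

/-- The characteristic function of `A`, as a (total) oracle. -/
noncomputable def charFun (A : Set ℕ) : ℕ →. ℕ :=
  open Classical in fun n => Part.some (if n ∈ A then 1 else 0)

/-- `A ≤_T Z` for sets of natural numbers. -/
def SetTuringReducible (A Z : Set ℕ) : Prop :=
  TuringReducible (charFun A) (charFun Z)

/-- The join `X ⊕ Y = {2n : n ∈ X} ∪ {2n + 1 : n ∈ Y}`. -/
def setJoin (X Y : Set ℕ) : Set ℕ :=
  {m | (∃ n ∈ X, m = 2 * n) ∨ (∃ n ∈ Y, m = 2 * n + 1)}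

/-- `A` is `Σ⁰ₙ` relative to `Z`: a `Z`-computable matrix preceded by `n` alternating number
quantifiers, the outermost one existential. At level `n + 1` the set `B` is `Π⁰ₙ` relative to `Z`,
that is, its complement is `Σ⁰ₙ` relative to `Z`. -/
def IsSigmaIn (Z : Set ℕ) : ℕ → Set ℕ → Prop
  | 0, A => SetTuringReducible A Z
  | n + 1, A => ∃ B : Set ℕ, IsSigmaIn Z n Bᶜ ∧ ∀ x, x ∈ A ↔ ∃ y, Nat.pair x y ∈ B

/-- `A` is `Π⁰ₙ` relative to `Z`. -/
def IsPiIn (Z : Set ℕ) (n : ℕ) (A : Set ℕ) : Prop :=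
  IsSigmaIn Z n Aᶜ

/-- `A` is `Δ⁰ₙ` relative to `Z`. -/
def IsDeltaIn (Z : Set ℕ) (n : ℕ) (A : Set ℕ) : Prop :=
  IsSigmaIn Z n A ∧ IsPiIn Z n A

/-- `A` is properly `Δ⁰ₙ₊₁` relative to `Z`: it is `Δ⁰ₙ₊₁` relative to `Z`, but neither `Σ⁰ₙ` nor
`Π⁰ₙ` relative to `Z`. -/
def IsProperlyDeltaSuccIn (Z : Set ℕ) (n : ℕ) (A : Set ℕ) : Prop :=
  IsDeltaIn Z (n + 1) A ∧ ¬ IsSigmaIn Z n A ∧ ¬ IsPiIn Z n A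

/-- `Y` preserves (properly) `Δ⁰ₙ₊₁`-definitions relative to `Z`. -/
def PreservesDeltaSuccDefinitions (n : ℕ) (Y Z : Set ℕ) : Prop :=
  ∀ A : Set ℕ, IsProperlyDeltaSuccIn Z n A → IsProperlyDeltaSuccIn (setJoin Z Y) n A

/-- The sentence `(∀ X)(∃ Y) φ(X, Y)` admits preservation of (properly) `Δ⁰ₙ₊₁`-definitions. -/
def AdmitsPreservationOfDeltaSuccDefinitions (n : ℕ) (φ : Set ℕ → Set ℕ → Prop) : Prop :=
  ∀ Z X : Set ℕ, SetTuringReducible X Z →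
    ∃ Y : Set ℕ, PreservesDeltaSuccDefinitions n Y Z ∧ φ X Y

/-- The binary relation on `ℕ` coded by a set of natural numbers. -/
def codedRel (X : Set ℕ) (x y : ℕ) : Prop :=
  Nat.pair x y ∈ X

/-- `R` is a tournament: it is induced by a colouring `c` of two-element sets with two colours,
where `c x y` is the colour of `{x, y}` for `x < y` (other values of `c` are irrelevant). If the
colour is `1` then the smaller element is related to the larger one, if it is `0` then the larger
one is related to the smaller one, and nothing else is related. -/
def IsTournament (R : ℕ → ℕ → Prop) : Prop :=
  ∃ c : ℕ → ℕ → Fin 2, ∀ x y, R x y ↔ (x < y ∧ c x y = 1) ∨ (y < x ∧ c y x = 0)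

/-- `Y` is transitive for `R`: the restriction of `R` to `Y` is a transitive relation. -/
def IsTransitiveFor (R : ℕ → ℕ → Prop) (Y : Set ℕ) : Prop :=
  ∀ x ∈ Y, ∀ y ∈ Y, ∀ z ∈ Y, R x y → R y z → R x z

/-- The matrix `φ(X, Y)` of the Erdős–Moser principle `EM = (∀ X)(∃ Y) φ(X, Y)`: if `X` codes a
tournament then `Y` is an infinite transitive set for it. -/
def EM (X Y : Set ℕ) : Prop :=
  IsTournament (codedRel X) → Y.Infinite ∧ IsTransitiveFor (codedRel X) Y

end DefStrength

namespace DefStrength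

open Encodable

/-! ### Primitive recursive predicates -/

/-! If `A` is properly `Δ⁰₂` in `Z`, then `A` and its complement are both `Σ⁰₂` but not `Σ⁰₁` in
`Z`. There are only countably many such sets, so it suffices to find one infinite transitive `Y`
such that `Z ⊕ Y` enumerates none of countably many sets that `Z` does not enumerate
(`exists_infinite_transitive_avoiding`).

This is done by Mathias-style forcing. A condition is a finite transitive set together with an
infinite reservoir `X`, enumerable in an oracle `c` that computes `z` and still avoids the family.
Each point of the finite part is related in one direction to the whole reservoir.

The heart is `IsCondition.exists_disagreement`. The eventual direction between a point and the
reservoir is not available effectively, so it is overapproximated by all 2-colourings of the points: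
ask whether every colouring admits a finite transitive homogeneous set of new points from `X` that
makes the operator accept `n`. By compactness of Cantor space the set of such `n` is enumerable in
`c`, hence differs from the target `A` at some `n`. If the answer is yes and `n ∉ A`, compactness
bounds the finite sets by some `N`. By pigeonhole infinitely many reservoir points induce one and
the same colouring below `N`, and a set homogeneous for that colouring is added
(`IsCondition.exists_extension`). If the answer is no and `n ∈ A`, the counterexample colourings
form a nonempty `Π⁰₁` class. A member that keeps the avoidance is chosen (`exists_path_avoiding`),
and the reservoir is cut down to an infinite colour class, from which `n` can never be accepted. -/

theorem PrimrecPred.exists_mem {α β : Type*} [Primcodable α] [Primcodable β] {q : α × β → Prop}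
    (hq : PrimrecPred q) {L : α → List β} (hL : Primrec L) :
    PrimrecPred fun a => ∃ b ∈ L a, q (a, b) :=
  (PrimrecRel.exists_mem_list (R := fun b a => q (a, b))
    (hq.comp (Primrec.pair Primrec.snd Primrec.fst))).comp hL Primrec.id

theorem PrimrecPred.forall_mem {α β : Type*} [Primcodable α] [Primcodable β] {q : α × β → Prop}
    (hq : PrimrecPred q) {L : α → List β} (hL : Primrec L) :
    PrimrecPred fun a => ∀ b ∈ L a, q (a, b) :=
  (PrimrecRel.forall_mem_list (R := fun b a => q (a, b))
    (hq.comp (Primrec.pair Primrec.snd Primrec.fst))).comp hL Primrec.id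

/-! ### Initial segments -/

/-- The initial segment of length `k` of the sequence `c`. -/
def initSeg {α : Type*} (c : ℕ → α) (k : ℕ) : List α :=
  (List.range k).map c

section initSeg

variable {α : Type*} (c : ℕ → α)

@[simp] theorem length_initSeg (k : ℕ) : (initSeg c k).length = k := by simp [initSeg]

theorem getElem?_initSeg {k i : ℕ} (h : i < k) : (initSeg c k)[i]? = some (c i) := by
  simp [initSeg, h]

theorem getElem?_initSeg_eq_some {k i : ℕ} {a : α} :
    (initSeg c k)[i]? = some a ↔ i < k ∧ c i = a := by
  rcases lt_or_ge i k with h | h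
  · rw [getElem?_initSeg c h]; simp [h]
  · simp [initSeg, h]

theorem getD_initSeg {k i : ℕ} (h : i < k) (d : α) : (initSeg c k).getD i d = c i := by
  simp [List.getD, getElem?_initSeg c h]

theorem initSeg_congr {c c' : ℕ → α} {k : ℕ} (h : ∀ i < k, c i = c' i) :
    initSeg c k = initSeg c' k :=
  List.map_congr_left fun i hi => h i (List.mem_range.1 hi)

theorem initSeg_succ (k : ℕ) : initSeg c (k + 1) = initSeg c k ++ [c k] := by
  simp [initSeg, List.range_succ]

theorem take_initSeg {j k : ℕ} (h : j ≤ k) : (initSeg c k).take j = initSeg c j := by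
  simp [initSeg, ← List.map_take, List.take_range, h]

theorem initSeg_prefix {j k : ℕ} (h : j ≤ k) : initSeg c j <+: initSeg c k := by
  rw [← take_initSeg c h]; exact List.take_prefix _ _

theorem eq_initSeg {l : List α} (h : ∀ i a, l[i]? = some a → c i = a) :
    l = initSeg c l.length := by
  refine List.ext_getElem (by simp) fun i h₁ h₂ => ?_
  have := h i l[i] (by simp [h₁])
  simp [initSeg, this]

theorem initSeg_getD (l : List α) (d : α) : initSeg (fun i => l.getD i d) l.length = l := by
  refine (eq_initSeg _ fun i a h => ?_).symm
  simp [List.getD, h]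

end initSeg

/-! ### Recursive enumerability relative to an oracle -/

/-- `p` is recursively enumerable in `c`, in the form given by the use principle: `p a` holds if
and only if a fixed primitive recursive predicate accepts `a` together with some initial segment
of `c`. -/
def OracleRE {α : Type*} [Primcodable α] (c : ℕ → ℕ) (p : α → Prop) : Prop :=
  ∃ V : α × List ℕ → Prop, PrimrecPred V ∧ ∀ a, p a ↔ ∃ k, V (a, initSeg c k)

namespace OracleRE

variable {α β : Type*} [Primcodable α] [Primcodable β] {c : ℕ → ℕ}

theorem of_iff {p q : α → Prop} (hp : OracleRE c p) (h : ∀ a, q a ↔ p a) : OracleRE c q := by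
  obtain ⟨V, hV, hp⟩ := hp
  exact ⟨V, hV, fun a => (h a).trans (hp a)⟩

theorem of_primrec {p : α → Prop} (hp : PrimrecPred p) : OracleRE c p :=
  ⟨fun x => p x.1, hp.comp Primrec.fst, by simp⟩

theorem comp {p : β → Prop} (hp : OracleRE c p) {f : α → β} (hf : Primrec f) :
    OracleRE c fun a => p (f a) := by
  obtain ⟨V, hV, hp⟩ := hp
  exact ⟨fun x => V (f x.1, x.2), hV.comp ((hf.comp Primrec.fst).pair Primrec.snd),
    fun a => hp _⟩

/-- The primitive recursive predicate may be taken to be monotone in the initial segment. -/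
theorem exists_monotone {p : α → Prop} (hp : OracleRE c p) :
    ∃ V : α × List ℕ → Prop, PrimrecPred V ∧
      (∀ a j k, j ≤ k → V (a, initSeg c j) → V (a, initSeg c k)) ∧
      ∀ a, p a ↔ ∃ k, V (a, initSeg c k) := by
  obtain ⟨V, hV, hp⟩ := hp
  refine ⟨fun x => ∃ j ∈ List.range (x.2.length + 1), V (x.1, x.2.take j), ?_, ?_, ?_⟩
  · refine PrimrecPred.exists_mem (q := fun y : (α × List ℕ) × ℕ => V (y.1.1, y.1.2.take y.2))
      (hV.comp ?_) ?_
    · exact (Primrec.fst.comp Primrec.fst).pair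
        (Primrec.list_take.comp Primrec.snd (Primrec.snd.comp Primrec.fst))
    · exact Primrec.list_range.comp (Primrec.succ.comp (Primrec.list_length.comp Primrec.snd))
  · rintro a j k hjk ⟨i, hi, h⟩
    simp only [length_initSeg, List.mem_range] at hi
    refine ⟨i, by simp; omega, ?_⟩
    rw [take_initSeg c (by omega)] at h ⊢
    exact h
  · intro a
    rw [hp]
    constructor
    · rintro ⟨k, hk⟩
      exact ⟨k, k, by simp, by rwa [take_initSeg c le_rfl]⟩
    · rintro ⟨k, i, hi, h⟩
      simp only [length_initSeg, List.mem_range] at hi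
      rw [take_initSeg c (by omega)] at h
      exact ⟨i, h⟩

theorem and {p q : α → Prop} (hp : OracleRE c p) (hq : OracleRE c q) :
    OracleRE c fun a => p a ∧ q a := by
  obtain ⟨V, hV, mV, hp⟩ := hp.exists_monotone
  obtain ⟨W, hW, mW, hq⟩ := hq.exists_monotone
  refine ⟨fun x => V x ∧ W x, hV.and hW, fun a => ?_⟩
  simp only [hp, hq]
  constructor
  · rintro ⟨⟨j, hj⟩, ⟨k, hk⟩⟩
    exact ⟨max j k, mV _ _ _ (le_max_left _ _) hj, mW _ _ _ (le_max_right _ _) hk⟩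
  · rintro ⟨k, h1, h2⟩
    exact ⟨⟨k, h1⟩, ⟨k, h2⟩⟩

theorem or {p q : α → Prop} (hp : OracleRE c p) (hq : OracleRE c q) :
    OracleRE c fun a => p a ∨ q a := by
  obtain ⟨V, hV, hp⟩ := hp
  obtain ⟨W, hW, hq⟩ := hq
  refine ⟨fun x => V x ∨ W x, hV.or hW, fun a => ?_⟩
  simp only [hp, hq, exists_or]

theorem forall_mem {q : α × β → Prop} (hq : OracleRE c q) {L : α → List β} (hL : Primrec L) :
    OracleRE c fun a => ∀ b ∈ L a, q (a, b) := by
  obtain ⟨V, hV, mV, hq⟩ := hq.exists_monotone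
  refine ⟨fun x => ∀ b ∈ L x.1, V ((x.1, b), x.2), ?_, fun a => ?_⟩
  · refine PrimrecPred.forall_mem (q := fun y : (α × List ℕ) × β => V ((y.1.1, y.2), y.1.2))
      (hV.comp ?_) (hL.comp Primrec.fst)
    exact ((Primrec.fst.comp Primrec.fst).pair Primrec.snd).pair (Primrec.snd.comp Primrec.fst)
  · simp only [hq]
    constructor
    · intro h
      choose! k hk using h
      -- The sum of the finitely many uses serves as a common upper bound.
      refine ⟨((L a).map k).sum, fun b hb => mV _ _ _ ?_ (hk b hb)⟩
      exact List.le_sum_of_mem (List.mem_map_of_mem hb)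
    · rintro ⟨k, h⟩ b hb
      exact ⟨k, h b hb⟩

theorem exists_mem {q : α × β → Prop} (hq : OracleRE c q) {L : α → List β} (hL : Primrec L) :
    OracleRE c fun a => ∃ b ∈ L a, q (a, b) := by
  obtain ⟨V, hV, hq⟩ := hq
  refine ⟨fun x => ∃ b ∈ L x.1, V ((x.1, b), x.2), ?_, fun a => ?_⟩
  · refine PrimrecPred.exists_mem (q := fun y : (α × List ℕ) × β => V ((y.1.1, y.2), y.1.2))
      (hV.comp ?_) (hL.comp Primrec.fst)
    exact ((Primrec.fst.comp Primrec.fst).pair Primrec.snd).pair (Primrec.snd.comp Primrec.fst)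
  · simp only [hq]
    exact ⟨fun ⟨b, hb, k, h⟩ => ⟨k, b, hb, h⟩, fun ⟨k, b, hb, h⟩ => ⟨b, hb, k, h⟩⟩

theorem exists_nat {q : α × ℕ → Prop} (hq : OracleRE c q) : OracleRE c fun a => ∃ n, q (a, n) := by
  obtain ⟨V, hV, mV, hq⟩ := hq.exists_monotone
  refine ⟨fun x => ∃ n ∈ List.range x.2.length, V ((x.1, n), x.2), ?_, fun a => ?_⟩
  · refine PrimrecPred.exists_mem (q := fun y : (α × List ℕ) × ℕ => V ((y.1.1, y.2), y.1.2))
      (hV.comp ?_) (Primrec.list_range.comp (Primrec.list_length.comp Primrec.snd))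
    exact ((Primrec.fst.comp Primrec.fst).pair Primrec.snd).pair (Primrec.snd.comp Primrec.fst)
  · simp only [hq]
    constructor
    · rintro ⟨n, k, h⟩
      -- The segment length also bounds the search, so it must exceed the witness `n`.
      exact ⟨max k (n + 1), n, by simp, mV _ _ _ (le_max_left _ _) h⟩
    · rintro ⟨k, n, -, h⟩
      exact ⟨n, k, h⟩

theorem exists_of {q : α × β → Prop} (hq : OracleRE c q) : OracleRE c fun a => ∃ b, q (a, b) := by
  have h : OracleRE c fun x : α × ℕ => ∃ b ∈ (decode (α := β) x.2).toList, q (x.1, b) := by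
    refine exists_mem (q := fun y : (α × ℕ) × β => q (y.1.1, y.2)) (hq.comp ?_) ?_
    · exact (Primrec.fst.comp Primrec.fst).pair Primrec.snd
    · exact Primrec.optionToList.comp (Primrec.decode.comp Primrec.snd)
  refine h.exists_nat.of_iff fun a => ?_
  simp only [Option.mem_toList]
  constructor
  · rintro ⟨b, hb⟩
    exact ⟨encode b, b, by simp, hb⟩
  · rintro ⟨n, b, -, hb⟩
    exact ⟨b, hb⟩

theorem graph (c : ℕ → ℕ) : OracleRE c fun x : ℕ × ℕ => c x.1 = x.2 := by
  refine ⟨fun y => y.2[y.1.1]? = some y.1.2, ?_, fun x => ?_⟩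
  · exact Primrec.eq.comp
      (Primrec.list_getElem?.comp Primrec.snd (Primrec.fst.comp Primrec.fst))
      (Primrec.option_some.comp (Primrec.snd.comp Primrec.fst))
  · simp only [getElem?_initSeg_eq_some]
    exact ⟨fun h => ⟨x.1 + 1, by omega, h⟩, fun ⟨_, _, h⟩ => h⟩

/-- Being an initial segment of a sequence computable in `c` is recursively enumerable in `c`. -/
theorem isInitSeg {d : ℕ → ℕ} (hd : OracleRE c fun x : ℕ × ℕ => d x.1 = x.2) :
    OracleRE c fun l : List ℕ => l = initSeg d l.length := by
  have h : OracleRE c fun l : List ℕ => ∀ i ∈ List.range l.length, d i = l.getD i 0 := by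
    refine forall_mem (q := fun x : List ℕ × ℕ => d x.2 = x.1.getD x.2 0)
      (hd.comp (Primrec.snd.pair ((Primrec.list_getD 0).comp Primrec.fst Primrec.snd)))
      (Primrec.list_range.comp Primrec.list_length)
  refine h.of_iff fun l => ?_
  simp only [List.mem_range]
  constructor
  · intro h i hi
    rw [h, getD_initSeg]
    simpa using hi
  · intro h
    exact ((initSeg_congr h).trans (initSeg_getD l 0)).symm

/-- Relative enumerability is transitive with respect to relative computability. -/
theorem subst {d : ℕ → ℕ} {p : α → Prop} (hp : OracleRE d p)
    (hd : OracleRE c fun x : ℕ × ℕ => d x.1 = x.2) : OracleRE c p := by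
  obtain ⟨V, hV, hp⟩ := hp
  have h : OracleRE c fun a => ∃ l : List ℕ, l = initSeg d l.length ∧ V (a, l) :=
    exists_of (q := fun x : α × List ℕ => x.2 = initSeg d x.2.length ∧ V x)
      ((hd.isInitSeg.comp Primrec.snd).and (of_primrec hV))
  refine h.of_iff fun a => ?_
  rw [hp]
  constructor
  · rintro ⟨k, hk⟩
    exact ⟨_, by simp, hk⟩
  · rintro ⟨l, hl, h⟩
    exact ⟨l.length, hl ▸ h⟩

end OracleRE

/-! ### Compactness of Cantor space -/

/-- All binary strings of length `N`. -/
def binStrings : ℕ → List (List Bool)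
  | 0 => [[]]
  | N + 1 => (binStrings N).flatMap fun s => [s ++ [false], s ++ [true]]

theorem mem_binStrings {N : ℕ} {s : List Bool} :
    s ∈ binStrings N ↔ ∃ g : ℕ → Bool, s = initSeg g N := by
  induction N generalizing s with
  | zero => simp [binStrings, initSeg]
  | succ N ih =>
    simp only [binStrings, List.mem_flatMap, ih]
    constructor
    · rintro ⟨_, ⟨g, rfl⟩, h⟩
      have key : ∀ b, ∃ g' : ℕ → Bool, initSeg g N ++ [b] = initSeg g' (N + 1) := fun b => by
        refine ⟨Function.update g N b, ?_⟩
        rw [initSeg_succ, Function.update_self]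
        congr 1
        exact initSeg_congr fun i hi => by rw [Function.update_of_ne hi.ne]
      simp only [List.mem_cons, List.not_mem_nil, or_false] at h
      rcases h with rfl | rfl <;> exact key _
    · rintro ⟨g, rfl⟩
      refine ⟨_, ⟨g, rfl⟩, ?_⟩
      rw [initSeg_succ]
      cases g N <;> simp

theorem primrec_binStrings : Primrec binStrings := by
  refine (Primrec.nat_rec₁ (f := fun _ L => L.flatMap fun s => [s ++ [false], s ++ [true]])
    [[]] ?_).of_eq fun n => ?_
  · refine Primrec.list_flatMap Primrec.snd ?_
    have h : ∀ b : Bool, Primrec fun x : (ℕ × List (List Bool)) × List Bool => x.2 ++ [b] :=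
      fun b => Primrec.list_append.comp Primrec.snd (Primrec.const _)
    exact Primrec.list_cons.comp (h false)
      (Primrec.list_cons.comp (h true) (Primrec.const []))
  · induction n with
    | zero => rfl
    | succ n ih => simp only [binStrings, ← ih]

/-- Compactness of Cantor space: a family of strings that bars every sequence bars them all
uniformly. -/
theorem exists_uniform_bar {U : List Bool → Prop} (h : ∀ g : ℕ → Bool, ∃ k, U (initSeg g k)) :
    ∃ N, ∀ g : ℕ → Bool, ∃ k ≤ N, U (initSeg g k) := by
  -- Membership depends on the first `k` coordinates only, that is, on a map into a discrete space.
  have hopen : ∀ k, IsOpen {g : ℕ → Bool | U (initSeg g k)} := by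
    intro k
    have hc : Continuous fun (g : ℕ → Bool) (i : Fin k) => g i :=
      continuous_pi fun i => continuous_apply _
    have : {g : ℕ → Bool | U (initSeg g k)} = (fun (g : ℕ → Bool) (i : Fin k) => g i) ⁻¹'
        {f | U (List.ofFn f)} := by
      ext g
      have : initSeg g k = List.ofFn fun i : Fin k => g i := by
        refine List.ext_getElem (by simp) fun i h₁ h₂ => by simp [initSeg]
      simp [this]
    rw [this]
    exact (isOpen_discrete _).preimage hc
  obtain ⟨t, ht⟩ := isCompact_univ.elim_finite_subcover _ hopen
    fun g _ => Set.mem_iUnion.2 (h g)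
  refine ⟨t.sup id, fun g => ?_⟩
  obtain ⟨k, hk, hg⟩ := Set.mem_iUnion₂.1 (ht (Set.mem_univ g))
  exact ⟨k, Finset.le_sup (f := id) hk, hg⟩

/-- Compactness turns the quantifier over sequences into a search for one level `N` at which each of
the finitely many strings has a prefix in `U`. This keeps the forcing questions enumerable. -/
theorem OracleRE.forall_cantor {α : Type*} [Primcodable α] {c : ℕ → ℕ} {U : α × List Bool → Prop}
    (hU : OracleRE c U) : OracleRE c fun a => ∀ g : ℕ → Bool, ∃ k, U (a, initSeg g k) := by
  have h1 : OracleRE c fun x : (α × ℕ) × List Bool =>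
      ∃ k ∈ List.range (x.1.2 + 1), U (x.1.1, x.2.take k) := by
    refine OracleRE.exists_mem (q := fun y : ((α × ℕ) × List Bool) × ℕ =>
      U (y.1.1.1, y.1.2.take y.2)) (hU.comp ?_) ?_
    · exact (Primrec.fst.comp (Primrec.fst.comp Primrec.fst)).pair
        (Primrec.list_take.comp Primrec.snd (Primrec.snd.comp Primrec.fst))
    · exact Primrec.list_range.comp (Primrec.succ.comp (Primrec.snd.comp Primrec.fst))
  have h2 := (h1.forall_mem (primrec_binStrings.comp Primrec.snd)).exists_nat
  refine h2.of_iff fun a => ?_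
  constructor
  · intro h
    obtain ⟨N, hN⟩ := exists_uniform_bar (U := fun l => U (a, l)) h
    refine ⟨N, fun s hs => ?_⟩
    obtain ⟨g, rfl⟩ := mem_binStrings.1 hs
    obtain ⟨k, hk, h⟩ := hN g
    exact ⟨k, by simp; omega, by simpa [take_initSeg g hk] using h⟩
  · rintro ⟨N, hN⟩ g
    obtain ⟨k, hk, h⟩ := hN _ (mem_binStrings.2 ⟨g, rfl⟩)
    have hk : k ≤ N := by simp at hk; omega
    exact ⟨k, by simpa [take_initSeg g hk] using h⟩

/-! ### Countability -/

theorem countable_primrecPred {α : Type*} [Primcodable α] :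
    {V : α → Prop | PrimrecPred V}.Countable := by
  have h1 : {f : ℕ → ℕ | Nat.Primrec f}.Countable :=
    (Set.countable_coe_iff.1 (inferInstanceAs (Countable {f : ℕ → ℕ // Computable f}))).mono
      fun f hf => (Primrec.nat_iff.2 hf).to_comp
  classical
  refine Set.MapsTo.countable_of_injOn
    (f := fun (V : α → Prop) (n : ℕ) => encode ((decode (α := α) n).map fun a => decide (V a)))
    ?_ ?_ h1
  · intro V hV
    exact hV.decide
  · intro V _ W _ h
    funext a
    have := congrFun h (encode a)
    simpa using this

theorem countable_oracleRE {α : Type*} [Primcodable α] (c : ℕ → ℕ) :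
    {p : α → Prop | OracleRE c p}.Countable := by
  refine ((countable_primrecPred (α := α × List ℕ)).image
    fun V a => ∃ k, V (a, initSeg c k)).mono ?_
  rintro p ⟨V, hV, h⟩
  exact ⟨V, hV, funext fun a => propext (h a).symm⟩

/-! ### The characteristic function as an oracle -/

/-- The characteristic function of `Z`. -/
noncomputable def chi (Z : Set ℕ) : ℕ → ℕ :=
  open Classical in fun n => if n ∈ Z then 1 else 0

theorem charFun_eq (Z : Set ℕ) (n : ℕ) : charFun Z n = Part.some (chi Z n) := rfl

theorem chi_eq_one {Z : Set ℕ} {n : ℕ} : chi Z n = 1 ↔ n ∈ Z := by simp [chi]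

theorem oracleRE_chi_mem (Z : Set ℕ) : OracleRE (chi Z) (· ∈ Z) :=
  ((OracleRE.graph (chi Z)).comp (Primrec.id.pair (Primrec.const 1))).of_iff
    fun _ => chi_eq_one.symm

/-- The use principle: the graph of a function recursive in `Z` is recursively enumerable in `Z`
with finite use. -/
theorem oracleRE_graph_of_recursiveIn {Z : Set ℕ} {f : ℕ →. ℕ}
    (hf : Nat.RecursiveIn {charFun Z} f) : OracleRE (chi Z) fun x : ℕ × ℕ => x.2 ∈ f x.1 := by
  induction hf with
  | zero =>
    exact (OracleRE.of_primrec (Primrec.eq.comp Primrec.snd (Primrec.const 0))).of_iff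
      fun x => Part.mem_some_iff
  | succ =>
    exact (OracleRE.of_primrec (Primrec.eq.comp Primrec.snd
      (Primrec.succ.comp Primrec.fst))).of_iff fun x => Part.mem_some_iff
  | left =>
    exact (OracleRE.of_primrec (Primrec.eq.comp Primrec.snd
      (Primrec.fst.comp (Primrec.unpair.comp Primrec.fst)))).of_iff fun x => Part.mem_some_iff
  | right =>
    exact (OracleRE.of_primrec (Primrec.eq.comp Primrec.snd
      (Primrec.snd.comp (Primrec.unpair.comp Primrec.fst)))).of_iff fun x => Part.mem_some_iff
  | oracle g hg =>
    obtain rfl : g = charFun Z := hg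
    exact (OracleRE.graph (chi Z)).of_iff fun x => by
      rw [charFun_eq, Part.mem_some_iff, eq_comm]
  | @pair f h _ _ ihf ihh =>
    have key : OracleRE (chi Z) fun x : ℕ × ℕ => ∃ y : ℕ × ℕ,
        (y.1 ∈ f x.1 ∧ y.2 ∈ h x.1) ∧ Nat.pair y.1 y.2 = x.2 := by
      refine OracleRE.exists_of (q := fun w : (ℕ × ℕ) × (ℕ × ℕ) =>
        (w.2.1 ∈ f w.1.1 ∧ w.2.2 ∈ h w.1.1) ∧ Nat.pair w.2.1 w.2.2 = w.1.2)
        (((ihf.comp (f := fun w : (ℕ × ℕ) × (ℕ × ℕ) => (w.1.1, w.2.1)) ?_).and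
          (ihh.comp (f := fun w : (ℕ × ℕ) × (ℕ × ℕ) => (w.1.1, w.2.2)) ?_)).and
          (OracleRE.of_primrec ?_))
      · exact (Primrec.fst.comp Primrec.fst).pair (Primrec.fst.comp Primrec.snd)
      · exact (Primrec.fst.comp Primrec.fst).pair (Primrec.snd.comp Primrec.snd)
      · exact Primrec.eq.comp (Primrec₂.natPair.comp (Primrec.fst.comp Primrec.snd)
          (Primrec.snd.comp Primrec.snd)) (Primrec.snd.comp Primrec.fst)
    refine key.of_iff fun x => ?_
    simp only [Seq.seq, Part.map_eq_map, Part.mem_bind_iff, Part.mem_map_iff, Prod.exists]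
    constructor
    · rintro ⟨_, ⟨a, ha, rfl⟩, b, hb, h⟩
      exact ⟨a, b, ⟨ha, hb⟩, h⟩
    · rintro ⟨a, b, ⟨ha, hb⟩, h⟩
      exact ⟨_, ⟨a, ha, rfl⟩, b, hb, h⟩
  | @comp f h _ _ ihf ihh =>
    have key : OracleRE (chi Z) fun x : ℕ × ℕ => ∃ y : ℕ, y ∈ h x.1 ∧ x.2 ∈ f y := by
      refine OracleRE.exists_of (q := fun w : (ℕ × ℕ) × ℕ => w.2 ∈ h w.1.1 ∧ w.1.2 ∈ f w.2)
        ((ihh.comp (f := fun w : (ℕ × ℕ) × ℕ => (w.1.1, w.2)) ?_).and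
          (ihf.comp (f := fun w : (ℕ × ℕ) × ℕ => (w.2, w.1.2)) ?_))
      · exact (Primrec.fst.comp Primrec.fst).pair Primrec.snd
      · exact Primrec.snd.pair (Primrec.snd.comp Primrec.fst)
    refine key.of_iff fun x => ?_
    exact Part.mem_bind_iff
  | @prec f h _ _ ihf ihh =>
    -- The list `l` records the successive values of the recursion; each step is checked locally.
    have key : OracleRE (chi Z) fun x : ℕ × ℕ => ∃ l : List ℕ,
        (l.getD 0 0 ∈ f x.1.unpair.1 ∧ l.getD x.1.unpair.2 0 = x.2) ∧
        ∀ y ∈ List.range x.1.unpair.2, l.getD (y + 1) 0 ∈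
          h (Nat.pair x.1.unpair.1 (Nat.pair y (l.getD y 0))) := by
      have hl : ∀ {γ : Type} [Primcodable γ] {u : γ → List ℕ} {v : γ → ℕ}, Primrec u →
          Primrec v → Primrec fun a => (u a).getD (v a) 0 :=
        fun hu hv => (Primrec.list_getD 0).comp hu hv
      refine OracleRE.exists_of (q := fun w : (ℕ × ℕ) × List ℕ =>
        (w.2.getD 0 0 ∈ f w.1.1.unpair.1 ∧ w.2.getD w.1.1.unpair.2 0 = w.1.2) ∧
        ∀ y ∈ List.range w.1.1.unpair.2, w.2.getD (y + 1) 0 ∈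
          h (Nat.pair w.1.1.unpair.1 (Nat.pair y (w.2.getD y 0))))
        (((ihf.comp (f := fun w : (ℕ × ℕ) × List ℕ => (w.1.1.unpair.1, w.2.getD 0 0)) ?_).and
          (OracleRE.of_primrec ?_)).and
        (OracleRE.forall_mem (q := fun w : ((ℕ × ℕ) × List ℕ) × ℕ => w.1.2.getD (w.2 + 1) 0 ∈
          h (Nat.pair w.1.1.1.unpair.1 (Nat.pair w.2 (w.1.2.getD w.2 0))))
          (ihh.comp (f := fun w : ((ℕ × ℕ) × List ℕ) × ℕ =>
            (Nat.pair w.1.1.1.unpair.1 (Nat.pair w.2 (w.1.2.getD w.2 0)),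
              w.1.2.getD (w.2 + 1) 0)) ?_) ?_))
      · exact (Primrec.fst.comp (Primrec.unpair.comp (Primrec.fst.comp Primrec.fst))).pair
          (hl Primrec.snd (Primrec.const 0))
      · exact Primrec.eq.comp (hl Primrec.snd
          (Primrec.snd.comp (Primrec.unpair.comp (Primrec.fst.comp Primrec.fst))))
          (Primrec.snd.comp Primrec.fst)
      · exact (Primrec₂.natPair.comp (Primrec.fst.comp (Primrec.unpair.comp
          (Primrec.fst.comp (Primrec.fst.comp Primrec.fst))))
          (Primrec₂.natPair.comp Primrec.snd (hl (Primrec.snd.comp Primrec.fst)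
            Primrec.snd))).pair
          (hl (Primrec.snd.comp Primrec.fst) (Primrec.succ.comp Primrec.snd))
      · exact Primrec.list_range.comp
          (Primrec.snd.comp (Primrec.unpair.comp (Primrec.fst.comp Primrec.fst)))
    refine key.of_iff fun ⟨p, m⟩ => ?_
    generalize hp : p.unpair = u
    obtain ⟨a, n⟩ := u
    simp only [hp, List.mem_range]
    clear hp
    induction n generalizing m with
    | zero =>
      constructor
      · intro hm
        exact ⟨[m], ⟨hm, rfl⟩, by simp⟩
      · rintro ⟨l, ⟨h1, rfl⟩, -⟩
        exact h1
    | succ n ih =>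
      simp only [Part.bind_eq_bind, Part.mem_bind_iff]
      constructor
      · rintro ⟨i, hi, hm⟩
        obtain ⟨l, ⟨h1, rfl⟩, h2⟩ := (ih i).1 hi
        -- The record `l` may have any length, so it is cut or padded to the entries `0, …, n`; this
        -- places `m` exactly at position `n + 1`.
        have hget : ∀ j ≤ n, (initSeg (fun j => l.getD j 0) (n + 1) ++ [m]).getD j 0
            = l.getD j 0 := fun j hj => by
          rw [List.getD_append _ _ _ _ (by simp; omega), getD_initSeg _ (by omega)]
        have hlast : (initSeg (fun j => l.getD j 0) (n + 1) ++ [m]).getD (n + 1) 0 = m := by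
          rw [List.getD_append_right _ _ _ _ (by simp)]
          simp
        refine ⟨initSeg (fun j => l.getD j 0) (n + 1) ++ [m], ⟨?_, hlast⟩, fun y hy => ?_⟩
        · rwa [hget 0 (by omega)]
        · rw [hget y (by omega)]
          rcases Nat.lt_succ_iff_lt_or_eq.1 hy with hy | rfl
          · rw [hget (y + 1) (by omega)]
            exact h2 y hy
          · rw [hlast]
            exact hm
      · rintro ⟨l, ⟨h1, rfl⟩, h2⟩
        exact ⟨l.getD n 0, (ih _).2 ⟨l, ⟨h1, rfl⟩, fun y hy => h2 y (by omega)⟩, h2 n (by omega)⟩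
  | @rfind f _ ihf =>
    -- Minimisation requires all earlier values to converge and be nonzero, which is a positive
    -- condition.
    have key : OracleRE (chi Z) fun x : ℕ × ℕ => 0 ∈ f (Nat.pair x.1 x.2) ∧
        ∀ n ∈ List.range x.2, ∃ m : ℕ, m ≠ 0 ∧ m ∈ f (Nat.pair x.1 n) := by
      refine (ihf.comp (f := fun x : ℕ × ℕ => (Nat.pair x.1 x.2, 0)) ?_).and
        (OracleRE.forall_mem (q := fun y : (ℕ × ℕ) × ℕ => ∃ m : ℕ, m ≠ 0 ∧
          m ∈ f (Nat.pair y.1.1 y.2)) (OracleRE.exists_of (q := fun w : ((ℕ × ℕ) × ℕ) × ℕ =>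
            w.2 ≠ 0 ∧ w.2 ∈ f (Nat.pair w.1.1.1 w.1.2)) ((OracleRE.of_primrec ?_).and
            (ihf.comp (f := fun w : ((ℕ × ℕ) × ℕ) × ℕ => (Nat.pair w.1.1.1 w.1.2, w.2)) ?_))) ?_)
      · exact (Primrec₂.natPair.comp Primrec.fst Primrec.snd).pair (Primrec.const 0)
      · exact (Primrec.eq.comp Primrec.snd (Primrec.const 0)).not
      · exact (Primrec₂.natPair.comp (Primrec.fst.comp (Primrec.fst.comp Primrec.fst))
          (Primrec.snd.comp Primrec.fst)).pair Primrec.snd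
      · exact Primrec.list_range.comp Primrec.snd
    refine key.of_iff fun x => ?_
    refine Nat.mem_rfind.trans ?_
    refine and_congr (by simp [Part.mem_map_iff]) ?_
    simp only [List.mem_range]
    refine forall_congr' fun m => forall_congr' fun _ => ?_
    simp only [Part.map_eq_map, Part.mem_map_iff, decide_eq_false_iff_not]
    exact exists_congr fun _ => and_comm

/-! ### Comparison with the arithmetical hierarchy -/

theorem oracleRE_graph_of_reducible {A Z : Set ℕ} (h : SetTuringReducible A Z) :
    OracleRE (chi Z) fun x : ℕ × ℕ => chi A x.1 = x.2 :=
  (oracleRE_graph_of_recursiveIn (RecursiveIn.iff_nat.1 h)).of_iff fun x => by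
    rw [charFun_eq, Part.mem_some_iff, eq_comm]

theorem oracleRE_of_isSigmaIn {A Z : Set ℕ} (h : IsSigmaIn Z 1 A) : OracleRE (chi Z) (· ∈ A) := by
  obtain ⟨B, hB, hA⟩ := h
  have h0 : OracleRE (chi Z) (· ∈ B) :=
    ((oracleRE_graph_of_reducible hB).comp (Primrec.id.pair (Primrec.const 0))).of_iff
      fun n => by simp [chi]
  refine (OracleRE.exists_of (q := fun x : ℕ × ℕ => Nat.pair x.1 x.2 ∈ B)
    (h0.comp (Primrec₂.natPair.comp Primrec.fst Primrec.snd))).of_iff hA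

theorem recursiveIn_of_primrec {O : Set (ℕ →. ℕ)} {f : ℕ → ℕ} (hf : Primrec f) :
    Nat.RecursiveIn O fun n => Part.some (f n) :=
  (Nat.Partrec.of_primrec (Primrec.nat_iff.1 hf)).recursiveIn

theorem recursiveIn_comp {O : Set (ℕ →. ℕ)} {f g : ℕ → ℕ}
    (hf : Nat.RecursiveIn O fun n => Part.some (f n))
    (hg : Nat.RecursiveIn O fun n => Part.some (g n)) :
    Nat.RecursiveIn O fun n => Part.some (f (g n)) :=
  (hf.comp hg).of_eq fun _ => Part.bind_some _ _

theorem recursiveIn_pair {O : Set (ℕ →. ℕ)} {f g : ℕ → ℕ}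
    (hf : Nat.RecursiveIn O fun n => Part.some (f n))
    (hg : Nat.RecursiveIn O fun n => Part.some (g n)) :
    Nat.RecursiveIn O fun n => Part.some (Nat.pair (f n) (g n)) :=
  (hf.pair hg).of_eq fun n => by simp [Seq.seq]

/-- Codes of initial segments of `chi Z` are computed from `Z` by recursion on the length, so the
use-principle predicate becomes a `Z`-computable matrix whose existential variable is that length.
-/
theorem isSigmaIn_of_oracleRE {A Z : Set ℕ} (h : OracleRE (chi Z) (· ∈ A)) : IsSigmaIn Z 1 A := by
  classical
  obtain ⟨V, hV, hA⟩ := h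
  refine ⟨{n | V (n.unpair.1, initSeg (chi Z) n.unpair.2)}, ?_, fun x => by simpa using hA x⟩
  have hor : Nat.RecursiveIn {charFun Z} fun n => Part.some (chi Z n) := .oracle _ rfl
  have h1 : Nat.RecursiveIn {charFun Z} fun w => Part.some (encode
      (((decode (α := List ℕ) w.unpair.2.unpair.2).getD []) ++ [chi Z w.unpair.2.unpair.1])) := by
    have hstep : Primrec fun w : ℕ => encode (((decode (α := List ℕ)
        (w.unpair.1.unpair.2.unpair.2)).getD []) ++ [w.unpair.2]) := by
      refine Primrec.encode.comp (Primrec.list_append.comp (Primrec.option_getD.comp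
        (Primrec.decode.comp ?_) (Primrec.const [])) (Primrec.list_cons.comp ?_ (Primrec.const [])))
      · exact Primrec.snd.comp (Primrec.unpair.comp (Primrec.snd.comp (Primrec.unpair.comp
          (Primrec.fst.comp Primrec.unpair))))
      · exact Primrec.snd.comp Primrec.unpair
    have hw : Primrec fun w : ℕ => w.unpair.2.unpair.1 :=
      Primrec.fst.comp (Primrec.unpair.comp (Primrec.snd.comp Primrec.unpair))
    exact (recursiveIn_comp (recursiveIn_of_primrec hstep) (recursiveIn_pair
      (recursiveIn_of_primrec Primrec.id) (recursiveIn_comp hor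
        (recursiveIn_of_primrec hw)))).of_eq fun w => by simp
  have h2 : Nat.RecursiveIn {charFun Z} fun w => Part.some
      (encode (initSeg (chi Z) w.unpair.2)) := by
    refine (Nat.RecursiveIn.prec
      (recursiveIn_of_primrec (Primrec.const (encode ([] : List ℕ)))) h1).of_eq fun w => ?_
    generalize w.unpair = u
    obtain ⟨a, n⟩ := u
    simp only
    induction n with
    | zero => rfl
    | succ n ih =>
      refine (congrArg (fun x => Part.bind x _) ih).trans ?_
      refine (Part.bind_some _ _).trans ?_
      simp [initSeg_succ]
  -- The negation appears because `IsSigmaIn` asks for the complement of the matrix to be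
  -- computable.
  have htest : Primrec fun w : ℕ => if ¬ V (w.unpair.1.unpair.1,
      (decode (α := List ℕ) w.unpair.2).getD []) then 1 else 0 := by
    refine Primrec.ite (PrimrecPred.not (hV.comp (Primrec.pair ?_ ?_)))
      (Primrec.const 1) (Primrec.const 0)
    · exact Primrec.fst.comp (Primrec.unpair.comp (Primrec.fst.comp Primrec.unpair))
    · exact Primrec.option_getD.comp (Primrec.decode.comp (Primrec.snd.comp Primrec.unpair))
        (Primrec.const [])
  refine RecursiveIn.iff_nat.2 ((recursiveIn_comp (recursiveIn_of_primrec htest)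
    (recursiveIn_pair (recursiveIn_of_primrec Primrec.id) h2)).of_eq fun w => ?_)
  simp [charFun_eq, chi]

theorem isSigmaIn_mono {Z W : Set ℕ} (h : SetTuringReducible Z W) :
    ∀ {n : ℕ} {A : Set ℕ}, IsSigmaIn Z n A → IsSigmaIn W n A
  | 0, _, hA => TuringReducible.trans hA h
  | _ + 1, _, ⟨B, hB, hA⟩ => ⟨B, isSigmaIn_mono h hB, hA⟩

theorem countable_isSigmaIn (Z : Set ℕ) : ∀ n : ℕ, {A | IsSigmaIn Z n A}.Countable
  | 0 => by
    refine Set.MapsTo.countable_of_injOn (f := fun (A : Set ℕ) (x : ℕ × ℕ) => chi A x.1 = x.2)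
      (fun A hA => oracleRE_graph_of_reducible hA) ?_ (countable_oracleRE (chi Z))
    intro A _ B _ h
    ext n
    have := congrFun h (n, 1)
    simpa [chi_eq_one] using this
  | n + 1 => by
    refine ((countable_isSigmaIn Z n).image
      fun B : Set ℕ => {x | ∃ y, Nat.pair x y ∈ Bᶜ}).mono ?_
    rintro A ⟨B, hB, hA⟩
    exact ⟨Bᶜ, hB, by ext x; simp [hA]⟩

theorem setTuringReducible_setJoin_left (Z Y : Set ℕ) : SetTuringReducible Z (setJoin Z Y) := by
  have h : Nat.RecursiveIn {charFun (setJoin Z Y)} fun n => Part.some (chi (setJoin Z Y) n) :=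
    .oracle _ rfl
  refine RecursiveIn.iff_nat.2 ((recursiveIn_comp h
    (recursiveIn_of_primrec Primrec.nat_double)).of_eq fun n => ?_)
  have : 2 * n ∈ setJoin Z Y ↔ n ∈ Z := by
    simp only [setJoin, Set.mem_ofPred_eq]
    constructor
    · rintro (⟨m, hm, h⟩ | ⟨m, hm, h⟩)
      · obtain rfl : n = m := by omega
        exact hm
      · omega
    · exact fun h => .inl ⟨n, h, rfl⟩
  rw [charFun_eq]
  by_cases hn : n ∈ Z <;> simp [chi, this, hn]

/-! ### Joining an oracle with a point of Cantor space -/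

/-- The join of the oracle `c` with the binary sequence `g`. -/
def oracleJoin (c : ℕ → ℕ) (g : ℕ → Bool) (n : ℕ) : ℕ := Nat.pair (c n) (g n).toNat

theorem oracleRE_graph_oracleJoin_left (c : ℕ → ℕ) (g : ℕ → Bool) :
    OracleRE (oracleJoin c g) fun x : ℕ × ℕ => c x.1 = x.2 := by
  refine (OracleRE.exists_of (q := fun y : (ℕ × ℕ) × ℕ =>
    oracleJoin c g y.1.1 = y.2 ∧ y.2.unpair.1 = y.1.2)
    (((OracleRE.graph _).comp (f := fun y : (ℕ × ℕ) × ℕ => (y.1.1, y.2)) ?_).and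
      (OracleRE.of_primrec ?_))).of_iff fun x => ?_
  · exact (Primrec.fst.comp Primrec.fst).pair Primrec.snd
  · exact Primrec.eq.comp (Primrec.fst.comp (Primrec.unpair.comp Primrec.snd))
      (Primrec.snd.comp Primrec.fst)
  · simp [oracleJoin]

theorem oracleRE_oracleJoin_right (c : ℕ → ℕ) (g : ℕ → Bool) (b : Bool) :
    OracleRE (oracleJoin c g) fun n : ℕ => g n = b := by
  refine (OracleRE.exists_of (q := fun y : ℕ × ℕ =>
    oracleJoin c g y.1 = y.2 ∧ y.2.unpair.2 = b.toNat)
    ((OracleRE.graph _).and (OracleRE.of_primrec ?_))).of_iff fun x => ?_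
  · exact Primrec.eq.comp (Primrec.snd.comp (Primrec.unpair.comp Primrec.snd)) (Primrec.const _)
  · cases hg : g x <;> cases b <;> simp [oracleJoin, hg]

/-- The string `τ`, joined with `z`, makes `V` accept `a`. -/
def Accepts {α : Type*} (z : ℕ → ℕ) (V : α × List ℕ → Prop) (a : α) (τ : List Bool) : Prop :=
  ∃ k ≤ τ.length, V (a, initSeg (oracleJoin z fun i => τ.getD i false) k)

section Accepts

variable {α : Type*} {z : ℕ → ℕ} {V : α × List ℕ → Prop}

/-- `oracleJoin` pairs values position by position, so its first `k` entries need only the first `k`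
entries of `g`; the padding in `Accepts` is never read. -/
theorem accepts_initSeg {a : α} {g : ℕ → Bool} {K : ℕ} :
    Accepts z V a (initSeg g K) ↔ ∃ k ≤ K, V (a, initSeg (oracleJoin z g) k) := by
  simp only [Accepts, length_initSeg]
  refine exists_congr fun k => and_congr_right fun hk => ?_
  rw [initSeg_congr (c' := oracleJoin z g)]
  intro i hi
  simp only [oracleJoin, getD_initSeg g (hi.trans_le hk)]

variable [Primcodable α]

theorem oracleRE_accepts (hV : PrimrecPred V) :
    OracleRE z fun x : α × List Bool => Accepts z V x.1 x.2 := by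
  refine ⟨fun y => y.1.2.length ≤ y.2.length ∧ ∃ k ∈ List.range (y.1.2.length + 1),
    V (y.1.1, (List.range k).map fun i => Nat.pair (y.2.getD i 0) (y.1.2.getD i false).toNat),
    PrimrecPred.and ?_ ?_, fun x => ?_⟩
  · exact Primrec.nat_le.comp (Primrec.list_length.comp (Primrec.snd.comp Primrec.fst))
      (Primrec.list_length.comp Primrec.snd)
  · refine PrimrecPred.exists_mem (q := fun w : ((α × List Bool) × List ℕ) × ℕ =>
      V (w.1.1.1, (List.range w.2).map fun i =>
        Nat.pair (w.1.2.getD i 0) (w.1.1.2.getD i false).toNat)) (hV.comp (Primrec.pair ?_ ?_)) ?_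
    · exact Primrec.fst.comp (Primrec.fst.comp Primrec.fst)
    · refine Primrec.list_map (Primrec.list_range.comp Primrec.snd) ?_
      refine Primrec₂.natPair.comp ?_ ?_
      · exact (Primrec.list_getD 0).comp (Primrec.snd.comp (Primrec.fst.comp Primrec.fst))
          Primrec.snd
      · exact (Primrec.dom_bool Bool.toNat).comp ((Primrec.list_getD false).comp
          (Primrec.snd.comp (Primrec.fst.comp (Primrec.fst.comp Primrec.fst))) Primrec.snd)
    · exact Primrec.list_range.comp (Primrec.succ.comp
        (Primrec.list_length.comp (Primrec.snd.comp Primrec.fst)))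
  · have key : ∀ K k, k ≤ K → ((List.range k).map fun i =>
        Nat.pair ((initSeg z K).getD i 0) (x.2.getD i false).toNat) =
        initSeg (oracleJoin z fun i => x.2.getD i false) k := by
      intro K k hk
      refine List.map_congr_left fun i hi => ?_
      rw [getD_initSeg z (by have := List.mem_range.1 hi; omega)]
      rfl
    simp only [length_initSeg, List.mem_range, Nat.lt_succ_iff]
    constructor
    · rintro ⟨k, hk, h⟩
      exact ⟨x.2.length, le_rfl, k, hk, by rwa [key _ _ hk]⟩
    · rintro ⟨K, hK, k, hk, h⟩
      exact ⟨k, hk, by rwa [key _ _ (hk.trans hK)] at h⟩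

end Accepts

/-! ### Generic sequences -/

/-- The Rasiowa–Sikorski argument: the requirement with number `n` is met at stage `n`, and stages
that number no requirement do nothing. -/
theorem exists_generic_sequence {P ι : Type*} [Countable ι] {r : P → P → Prop}
    (hrefl : ∀ p, r p p) (htrans : ∀ p q s, r p q → r q s → r p s) {D : ι → P → Prop}
    (hD : ∀ i p, ∃ q, r p q ∧ D i q) (p : P) :
    ∃ s : ℕ → P, s 0 = p ∧ (∀ m n, m ≤ n → r (s m) (s n)) ∧ ∀ i, ∃ n, D i (s n) := by
  obtain ⟨f, hf⟩ := exists_injective_nat ι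
  have hstep : ∀ (n : ℕ) (p : P), ∃ q, r p q ∧ ∀ i, f i = n → D i q := by
    intro n p
    by_cases h : ∃ i, f i = n
    · obtain ⟨i, rfl⟩ := h
      obtain ⟨q, hq, hi⟩ := hD i p
      exact ⟨q, hq, fun j hj => hf hj ▸ hi⟩
    · exact ⟨p, hrefl p, fun i hi => (h ⟨i, hi⟩).elim⟩
  choose next h1 h2 using hstep
  refine ⟨fun n => Nat.rec p next n, rfl, fun m n hmn => ?_, fun i => ⟨f i + 1, h2 _ _ i rfl⟩⟩
  induction n, hmn using Nat.le_induction with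
  | base => exact hrefl _
  | succ n _ ih => exact htrans _ _ _ ih (h1 n _)

/-- A set that is not recursively enumerable in `c` differs from every recursively enumerable
predicate. -/
theorem exists_disagreement {c : ℕ → ℕ} {A : Set ℕ} (hA : ¬ OracleRE c (· ∈ A)) {p : ℕ → Prop}
    (hp : OracleRE c p) : ∃ n, (p n ∧ n ∉ A) ∨ (n ∈ A ∧ ¬ p n) := by
  by_contra! h
  exact hA (hp.of_iff fun n => ⟨(h n).2, (h n).1⟩)

/-! ### Members of `Π⁰₁` classes -/

/-- The nonempty `Π⁰₁` classes relative to `c`, given by enumerable sets of forbidden strings. -/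
abbrev PiClass (c : ℕ → ℕ) : Type :=
  {T : List Bool → Prop // OracleRE c T ∧ ∃ g : ℕ → Bool, ∀ k, ¬ T (initSeg g k)}

/-- Every nonempty `Π⁰₁` class relative to `c` has a member that, joined with `c`, does not
enumerate any of countably many sets that `c` does not enumerate. -/
theorem exists_path_avoiding {c : ℕ → ℕ} {𝒜 : Set (Set ℕ)} (h𝒜 : 𝒜.Countable)
    (hc : ∀ A ∈ 𝒜, ¬ OracleRE c (· ∈ A)) {T : List Bool → Prop} (hT : OracleRE c T)
    (hne : ∃ g : ℕ → Bool, ∀ k, ¬ T (initSeg g k)) :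
    ∃ g : ℕ → Bool, (∀ k, ¬ T (initSeg g k)) ∧
      ∀ A ∈ 𝒜, ¬ OracleRE (oracleJoin c g) (· ∈ A) := by
  have : Countable 𝒜 := h𝒜
  have : Countable {V : ℕ × List ℕ → Prop // PrimrecPred V} := countable_primrecPred
  have hstep : ∀ (i : 𝒜 × {V : ℕ × List ℕ → Prop // PrimrecPred V})
      (T : PiClass c), ∃ T' : PiClass c,
        (∀ l, T.1 l → T'.1 l) ∧ ∀ g : ℕ → Bool, (∀ k, ¬ T'.1 (initSeg g k)) →
          ¬ ∀ n, n ∈ i.1.1 ↔ ∃ k, i.2.1 (n, initSeg (oracleJoin c g) k) := by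
    rintro ⟨⟨A, hA⟩, ⟨V, hV⟩⟩ ⟨T, hT, hne⟩
    -- A string is good for `n` if it has left the class or already accepts `n`. By compactness, the
    -- `n` for which good strings bar Cantor space form a set enumerable in `c`, which therefore
    -- differs from `A`.
    have hU : OracleRE c fun x : ℕ × List Bool => T x.2 ∨ Accepts c V x.1 x.2 :=
      (hT.comp Primrec.snd).or (oracleRE_accepts hV)
    obtain ⟨n, ⟨hn, hnA⟩ | ⟨hnA, hn⟩⟩ := exists_disagreement (hc A hA) hU.forall_cantor
    -- Every member of the class already accepts some `n ∉ A`, so the class is kept unchanged.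
    · refine ⟨⟨T, hT, hne⟩, fun _ h => h, fun g hg h => hnA ((h n).2 ?_)⟩
      obtain ⟨k, hk | hk⟩ := hn g
      · exact (hg k hk).elim
      · obtain ⟨j, -, hj⟩ := accepts_initSeg.1 hk
        exact ⟨j, hj⟩
    · push Not at hn
      -- Here `n ∈ A`, and the class is shrunk to its members that never accept `n`; one exists.
      refine ⟨⟨fun l => T l ∨ Accepts c V n l, hU.comp ((Primrec.const n).pair Primrec.id),
        hn.imp fun g hg k => by simpa using hg k⟩, fun _ h => .inl h, fun g hg h => ?_⟩
      obtain ⟨k, hk⟩ := (h n).1 hnA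
      exact hg k (.inr (accepts_initSeg.2 ⟨k, le_rfl, hk⟩))
  obtain ⟨s, hs0, hs, hsD⟩ := exists_generic_sequence
    (P := PiClass c) (r := fun T T' => ∀ l, T.1 l → T'.1 l) (fun _ _ h => h)
    (fun _ _ _ h1 h2 l h => h2 l (h1 l h)) hstep ⟨T, hT, hne⟩
  have hex : ∃ g : ℕ → Bool, ∀ n k, ¬ (s n).1 (initSeg g k) := by
    by_contra! h
    -- Bounding the stage as well as the prefix by the length lets one `N` bound both, so an empty
    -- intersection would already make the class `s N` empty.
    obtain ⟨N, hN⟩ := exists_uniform_bar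
      (U := fun l => ∃ n ≤ l.length, ∃ j ≤ l.length, (s n).1 (l.take j)) fun g => by
        obtain ⟨n, k, hk⟩ := h g
        exact ⟨max n k, n, by simp, k, by simp, by rwa [take_initSeg g (le_max_right _ _)]⟩
    obtain ⟨g, hg⟩ := (s N).2.2
    obtain ⟨k, hk, n, hn, j, hj, h⟩ := hN g
    simp only [length_initSeg] at hn hj
    rw [take_initSeg g hj] at h
    exact hg j (hs n N (hn.trans hk) _ h)
  obtain ⟨g, hg⟩ := hex
  refine ⟨g, fun k hk => hg 0 k (by rwa [hs0]), fun A hA ⟨V, hV, h⟩ => ?_⟩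
  obtain ⟨n, hn⟩ := hsD (⟨A, hA⟩, ⟨V, hV⟩)
  exact hn g (hg n) h

/-! ### Tournaments -/

theorem IsTournament.irrefl {R : ℕ → ℕ → Prop} (hR : IsTournament R) (x : ℕ) : ¬ R x x := by
  obtain ⟨c, hc⟩ := hR
  simp [hc]

theorem IsTournament.asymm {R : ℕ → ℕ → Prop} (hR : IsTournament R) {x y : ℕ} (h : R x y) :
    ¬ R y x := by
  obtain ⟨c, hc⟩ := hR
  rw [hc] at h ⊢
  rintro (h' | h')
  · rcases h with h | h
    · omega
    · exact absurd (h.2.symm.trans h'.2) (by decide)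
  · rcases h with h | h
    · exact absurd (h.2.symm.trans h'.2) (by decide)
    · omega

theorem IsTournament.total {R : ℕ → ℕ → Prop} (hR : IsTournament R) {x y : ℕ} (h : x ≠ y) :
    R x y ∨ R y x := by
  obtain ⟨c, hc⟩ := hR
  have h2 : ∀ b : Fin 2, b = 0 ∨ b = 1 := by decide
  rw [hc, hc]
  rcases lt_or_gt_of_ne h with h | h
  · rcases h2 (c x y) with hb | hb <;> simp [h, hb]
  · rcases h2 (c y x) with hb | hb <;> simp [h, hb]

theorem IsTournament.not_iff {R : ℕ → ℕ → Prop} (hR : IsTournament R) {x y : ℕ} :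
    ¬ R x y ↔ x = y ∨ R y x := by
  constructor
  · intro h
    by_contra! h'
    exact (hR.total h'.1).elim h h'.2
  · rintro (rfl | h)
    · exact hR.irrefl x
    · exact hR.asymm h

theorem IsTransitiveFor.mono {R : ℕ → ℕ → Prop} {Y Y' : Set ℕ} (h : IsTransitiveFor R Y)
    (hY : Y' ⊆ Y) : IsTransitiveFor R Y' :=
  fun x hx y hy z hz => h x (hY hx) y (hY hy) z (hY hz)

/-- If `E` lies in a set `X` such that each point of `F` dominates or is dominated by all of `X`,
and `F` is transitive together with each point of `X`, then transitivity of `E` is inherited by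
`F ∪ E`. -/
theorem IsTransitiveFor.union {R : ℕ → ℕ → Prop} (hR : IsTournament R) {F E X : Set ℕ}
    (hX : X.Nonempty) (hF : ∀ x ∈ X, IsTransitiveFor R (insert x F))
    (hu : ∀ a ∈ F, (∀ x ∈ X, R a x) ∨ ∀ x ∈ X, R x a) (hEX : E ⊆ X) (hE : IsTransitiveFor R E) :
    IsTransitiveFor R (F ∪ E) := by
  intro x hx y hy z hz hxy hyz
  obtain ⟨w, hw⟩ := hX
  have mem : ∀ {w a : ℕ}, a ∈ F → a ∈ insert w F := fun h => Set.mem_insert_of_mem _ h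
  have self : ∀ {w : ℕ}, w ∈ insert w F := fun {w} => Set.mem_insert w F
  rcases hx with hx | hx <;> rcases hy with hy | hy <;> rcases hz with hz | hz
  · exact hF w hw x (mem hx) y (mem hy) z (mem hz) hxy hyz
  · exact hF z (hEX hz) x (mem hx) y (mem hy) z self hxy hyz
  · exact hF y (hEX hy) x (mem hx) y self z (mem hz) hxy hyz
  · rcases hu x hx with h | h
    · exact h z (hEX hz)
    · exact (hR.asymm hxy (h y (hEX hy))).elim
  · exact hF x (hEX hx) x self y (mem hy) z (mem hz) hxy hyz
  -- A point of `F` is related the same way to all of `X`, so it cannot lie between two points of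
  -- `E`.
  · rcases hu y hy with h | h
    · exact (hR.asymm hxy (h x (hEX hx))).elim
    · exact (hR.asymm hyz (h z (hEX hz))).elim
  · rcases hu z hz with h | h
    · exact (hR.asymm hyz (h y (hEX hy))).elim
    · exact h x (hEX hx)
  · exact hE x hx y hy z hz hxy hyz

/-- A transitive set all of whose points relate to `w` in the same way stays transitive when `w`
is added. -/
theorem IsTransitiveFor.insert_of_uniform {R : ℕ → ℕ → Prop} (hR : IsTournament R) {E : Set ℕ}
    {w : ℕ} (hE : IsTransitiveFor R E) (h : (∀ e ∈ E, R e w) ∨ ∀ e ∈ E, R w e) :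
    IsTransitiveFor R (insert w E) := by
  -- Uniformity forbids `w` to have both a successor and a predecessor in `E`.
  have key : ∀ a ∈ E, ¬ (R w a ∧ ∃ b ∈ E, R b w) := by
    rintro a ha ⟨h1, b, hb, h2⟩
    rcases h with h | h
    · exact hR.asymm h1 (h a ha)
    · exact hR.asymm h2 (h b hb)
  rintro x (rfl | hx) y (rfl | hy) z (rfl | hz) hxy hyz
  · exact hxy
  · exact hyz
  · exact (key y hy ⟨hxy, y, hy, hyz⟩).elim
  · rcases h with h | h
    · exact (hR.asymm hxy (h y hy)).elim
    · exact h z hz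
  · exact hxy
  · exact (key z hz ⟨hyz, x, hx, hxy⟩).elim
  · rcases h with h | h
    · exact h x hx
    · exact (hR.asymm hyz (h y hy)).elim
  · exact hE x hx y hy z hz hxy hyz

/-! ### Forcing conditions -/

/-- The set with characteristic string `σ`. -/
def supp (σ : List Bool) : Set ℕ := {i | σ.getD i false = true}

/-- The elements of `supp τ` that are not below the length of `σ`. -/
def newPart (σ τ : List Bool) : List ℕ :=
  (List.range τ.length).filter fun i => decide (σ.length ≤ i ∧ τ.getD i false = true)

theorem lt_length_of_mem_supp {σ : List Bool} {i : ℕ} (h : i ∈ supp σ) : i < σ.length := by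
  by_contra hi
  have : σ.getD i false = true := h
  rw [List.getD_eq_default _ _ (by omega)] at this
  simp at this

theorem mem_newPart {σ τ : List Bool} {i : ℕ} :
    i ∈ newPart σ τ ↔ σ.length ≤ i ∧ i ∈ supp τ := by
  constructor
  · intro h
    have := (List.mem_filter.1 h).2
    exact of_decide_eq_true (p := σ.length ≤ i ∧ τ.getD i false = true) this
  · rintro ⟨h1, h2⟩
    refine List.mem_filter.2 ⟨List.mem_range.2 (lt_length_of_mem_supp h2), ?_⟩
    have h2 : τ.getD i false = true := h2
    simp only [h1, h2, and_self, decide_true]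

theorem mem_supp_of_prefix {σ τ : List Bool} (h : σ <+: τ) {i : ℕ} (hi : i < σ.length) :
    i ∈ supp τ ↔ i ∈ supp σ := by
  obtain ⟨ρ, rfl⟩ := h
  change (σ ++ ρ).getD i false = true ↔ σ.getD i false = true
  rw [List.getD_append _ _ _ _ hi]

theorem supp_eq_union {σ τ : List Bool} (h : σ <+: τ) :
    supp τ = supp σ ∪ {i | i ∈ newPart σ τ} := by
  ext i
  rcases lt_or_ge i σ.length with hi | hi
  · have : i ∉ newPart σ τ := fun h' => by have := (mem_newPart.1 h').1; omega
    simp [mem_supp_of_prefix h hi, this]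
  · have : i ∉ supp σ := fun h' => by have := lt_length_of_mem_supp h'; omega
    simp [mem_newPart, hi, this]

theorem primrec_newPart (σ : List Bool) : Primrec fun τ => newPart σ τ := by
  have hR : PrimrecRel fun (i : ℕ) (τ : List Bool) =>
      σ.length ≤ i ∧ τ.getD i false = true :=
    PrimrecPred.and (Primrec.nat_le.comp (Primrec.const _) Primrec.fst)
      (Primrec.eq.comp ((Primrec.list_getD false).comp Primrec.snd Primrec.fst)
        (Primrec.const true))
  exact (hR.listFilter).comp (Primrec.list_range.comp Primrec.list_length) Primrec.id

/-- The string `τ` extends `σ` by a transitive set of elements of `X`. -/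
structure IsExtension (R : ℕ → ℕ → Prop) (σ : List Bool) (X : Set ℕ) (τ : List Bool) : Prop where
  isPrefix : σ <+: τ
  subset : ∀ i ∈ newPart σ τ, i ∈ X
  transitive : ∀ i ∈ newPart σ τ, ∀ j ∈ newPart σ τ, ∀ k ∈ newPart σ τ, R i j → R j k → R i k

/-- In a tournament the complement of `R` is enumerable too, being equality or the reversed
relation; hence the implications in transitivity can be enumerated. -/
theorem oracleRE_isExtension {R : ℕ → ℕ → Prop} (hR : IsTournament R) {c : ℕ → ℕ}
    (hRc : OracleRE c fun x : ℕ × ℕ => R x.1 x.2) {X : Set ℕ} (hX : OracleRE c (· ∈ X))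
    (σ : List Bool) : OracleRE c (IsExtension R σ X) := by
  have h1 : PrimrecPred fun τ : List Bool => τ.take σ.length = σ :=
    Primrec.eq.comp (Primrec.list_take.comp (Primrec.const _) Primrec.id) (Primrec.const σ)
  have h2 : OracleRE c fun τ => ∀ i ∈ newPart σ τ, i ∈ X :=
    OracleRE.forall_mem (q := fun x : List Bool × ℕ => x.2 ∈ X) (hX.comp Primrec.snd)
      (primrec_newPart σ)
  have hR' : OracleRE c fun x : ℕ × ℕ => ¬ R x.1 x.2 :=
    ((OracleRE.of_primrec (Primrec.eq.comp Primrec.fst Primrec.snd)).or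
      (hRc.comp (Primrec.snd.pair Primrec.fst))).of_iff fun x => hR.not_iff
  have h3 : OracleRE c fun τ => ∀ i ∈ newPart σ τ, ∀ j ∈ newPart σ τ, ∀ k ∈ newPart σ τ,
      R i j → R j k → R i k := by
    refine OracleRE.forall_mem (q := fun x : List Bool × ℕ => ∀ j ∈ newPart σ x.1,
      ∀ k ∈ newPart σ x.1, R x.2 j → R j k → R x.2 k) ?_ (primrec_newPart σ)
    refine OracleRE.forall_mem (q := fun x : (List Bool × ℕ) × ℕ =>
      ∀ k ∈ newPart σ x.1.1, R x.1.2 x.2 → R x.2 k → R x.1.2 k) ?_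
      ((primrec_newPart σ).comp Primrec.fst)
    refine OracleRE.forall_mem (q := fun x : ((List Bool × ℕ) × ℕ) × ℕ =>
      R x.1.1.2 x.1.2 → R x.1.2 x.2 → R x.1.1.2 x.2) ?_
      ((primrec_newPart σ).comp (Primrec.fst.comp Primrec.fst))
    have hi : Primrec fun x : ((List Bool × ℕ) × ℕ) × ℕ => x.1.1.2 :=
      Primrec.snd.comp (Primrec.fst.comp Primrec.fst)
    have hj : Primrec fun x : ((List Bool × ℕ) × ℕ) × ℕ => x.1.2 :=
      Primrec.snd.comp Primrec.fst
    refine ((hR'.comp (hi.pair hj)).or ((hR'.comp (hj.pair Primrec.snd)).or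
      (hRc.comp (hi.pair Primrec.snd)))).of_iff fun x => ?_
    simp only [imp_iff_not_or]
  refine (((OracleRE.of_primrec h1).and h2).and h3).of_iff fun τ => ?_
  constructor
  · rintro ⟨h1, h2, h3⟩
    exact ⟨⟨(List.prefix_iff_eq_take.1 h1).symm, h2⟩, h3⟩
  · rintro ⟨⟨h1, h2⟩, h3⟩
    exact ⟨List.prefix_iff_eq_take.2 h1.symm, h2, h3⟩

/-- The condition with finite part `supp σ` and reservoir `X`, where `X` is enumerable in the
oracle `c`, which computes `z` and does not enumerate any member of `𝒜`. -/
structure IsCondition (R : ℕ → ℕ → Prop) (z : ℕ → ℕ) (𝒜 : Set (Set ℕ)) (σ : List Bool)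
    (X : Set ℕ) (c : ℕ → ℕ) : Prop where
  infinite : X.Infinite
  oracleRE : OracleRE c (· ∈ X)
  graph : OracleRE c fun x : ℕ × ℕ => z x.1 = x.2
  avoids : ∀ A ∈ 𝒜, ¬ OracleRE c (· ∈ A)
  transitive : ∀ x ∈ X, IsTransitiveFor R (insert x (supp σ))
  uniform : ∀ a ∈ supp σ, (∀ x ∈ X, R a x) ∨ ∀ x ∈ X, R x a

/-- A finite part that can be chosen homogeneously for every colouring of the points below `N`
can be chosen so that infinitely many elements of the reservoir are compatible with it. -/
theorem IsCondition.exists_extension {R : ℕ → ℕ → Prop} (hR : IsTournament R) {z : ℕ → ℕ}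
    (hRz : OracleRE z fun x : ℕ × ℕ => R x.1 x.2) {𝒜 : Set (Set ℕ)} {σ : List Bool} {X : Set ℕ}
    {c : ℕ → ℕ} (hp : IsCondition R z 𝒜 σ X c) (N : ℕ) {Q : List Bool → Prop}
    (h : ∀ g : ℕ → Bool, ∃ τ, τ.length ≤ N ∧ IsExtension R σ X τ ∧
      (∃ b, ∀ i ∈ newPart σ τ, g i = b) ∧ Q τ) :
    ∃ τ X', IsCondition R z 𝒜 τ X' c ∧ IsExtension R σ X τ ∧ X' ⊆ X ∧ Q τ := by
  classical
  -- Only points from `N` on are used, so that they differ from, and hence are comparable to, every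
  -- `i < N`.
  have hinf : (X ∩ {y | N ≤ y}).Infinite := by
    have : X \ (X ∩ {y | N ≤ y}) ⊆ Set.Iio N := by
      rintro y ⟨hy, hy'⟩
      by_contra hN
      exact hy' ⟨hy, show N ≤ y from not_lt.1 hN⟩
    intro hfin
    refine hp.infinite (((Set.finite_Iio N).subset this).union hfin |>.subset fun y hy => ?_)
    by_cases hy' : y ∈ X ∩ {y | N ≤ y}
    · exact .inr hy'
    · exact .inl ⟨hy, hy'⟩
  have := hinf.to_subtype
  -- Pigeonhole: infinitely many `y` induce the same pattern `f` of directions towards the points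
  -- below `N`. The hypothesis is applied to this pattern as a colouring.
  obtain ⟨f, hf⟩ := Finite.exists_infinite_fiber
    fun (y : ↥(X ∩ {y | N ≤ y})) (i : Fin N) => decide (R i y)
  let g : ℕ → Bool := fun i => if hi : i < N then f ⟨i, hi⟩ else false
  obtain ⟨τ, hτN, hτ, ⟨b, hb⟩, hQ⟩ := h g
  -- The pattern enters as a finite string and `¬ R i y` is replaced by `R y i`, so `X'` is
  -- enumerable in the same oracle `c`.
  let X' : Set ℕ := {y | y ∈ X ∧ N ≤ y ∧ ∀ i ∈ List.range N,
    ((initSeg g N).getD i false = true ∧ R i y) ∨ ((initSeg g N).getD i false = false ∧ R y i)}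
  have hsub : X' ⊆ X := fun y hy => hy.1
  have hX' : ∀ y ∈ X', ∀ i < N, (g i = true → R i y) ∧ (g i = false → R y i) := by
    rintro y ⟨-, -, hy⟩ i hi
    have := hy i (List.mem_range.2 hi)
    rw [getD_initSeg g hi] at this
    constructor <;> intro hg <;> simpa [hg] using this
  have hRc : OracleRE c fun x : ℕ × ℕ => R x.1 x.2 := hRz.subst hp.graph
  have hnew : ∀ i ∈ newPart σ τ, i < N := fun i hi =>
    (lt_length_of_mem_supp (mem_newPart.1 hi).2).trans_le hτN
  have huni : (∀ y ∈ X', ∀ i ∈ newPart σ τ, R i y) ∨ ∀ y ∈ X', ∀ i ∈ newPart σ τ, R y i := by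
    cases b
    · exact .inr fun y hy i hi => (hX' y hy i (hnew i hi)).2 (hb i hi)
    · exact .inl fun y hy i hi => (hX' y hy i (hnew i hi)).1 (hb i hi)
  refine ⟨τ, X', ⟨?_, ?_, hp.graph, hp.avoids, ?_, ?_⟩, hτ, hsub, hQ⟩
  · refine ((Set.infinite_coe_iff.1 hf).image Subtype.val_injective.injOn).mono ?_
    rintro _ ⟨⟨y, hyX, hyN⟩, hy, rfl⟩
    refine ⟨hyX, hyN, fun i hi => ?_⟩
    have hi := List.mem_range.1 hi
    have hyN : N ≤ y := hyN
    have hgi : g i = decide (R i y) := by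
      have : (fun i : Fin N => decide (R i y)) = f := hy
      simp [g, hi, ← this]
    rw [getD_initSeg g hi, hgi]
    by_cases hRi : R i y
    · simp [hRi]
    · refine .inr ⟨by simp [hRi], (hR.total (show i ≠ y by omega)).resolve_left hRi⟩
  · have hg : Primrec fun x : ℕ × ℕ => (initSeg g N).getD x.2 false :=
      (Primrec.list_getD false).comp (Primrec.const _) Primrec.snd
    refine hp.oracleRE.and ((OracleRE.of_primrec
      (Primrec.nat_le.comp (Primrec.const N) Primrec.id)).and ?_)
    refine OracleRE.forall_mem (q := fun x : ℕ × ℕ =>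
      ((initSeg g N).getD x.2 false = true ∧ R x.2 x.1) ∨
        ((initSeg g N).getD x.2 false = false ∧ R x.1 x.2)) (OracleRE.or ?_ ?_) (Primrec.const _)
    · exact (OracleRE.of_primrec (Primrec.eq.comp hg (Primrec.const true))).and
        (hRc.comp (Primrec.snd.pair Primrec.fst))
    · exact (OracleRE.of_primrec (Primrec.eq.comp hg (Primrec.const false))).and hRc
  · intro y hy
    have hE : IsTransitiveFor R {i | i ∈ newPart σ τ} :=
      fun i hi j hj k hk => hτ.transitive i hi j hj k hk
    have hE' : IsTransitiveFor R (insert y {i | i ∈ newPart σ τ}) :=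
      hE.insert_of_uniform hR (huni.imp (fun h => h y hy) fun h => h y hy)
    refine (IsTransitiveFor.union hR hp.infinite.nonempty hp.transitive hp.uniform ?_ hE').mono ?_
    · rintro i (rfl | hi)
      · exact hsub hy
      · exact hτ.subset i hi
    · rw [supp_eq_union hτ.isPrefix]
      rintro i (rfl | hi | hi)
      · exact .inr (.inl rfl)
      · exact .inl hi
      · exact .inr (.inr hi)
  · intro a ha
    rw [supp_eq_union hτ.isPrefix] at ha
    rcases ha with ha | ha
    · exact (hp.uniform a ha).imp (fun h x hx => h x (hsub hx)) fun h x hx => h x (hsub hx)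
    · exact huni.imp (fun h x hx => h x hx a ha) fun h x hx => h x hx a ha

/-- A single new point is homogeneous for every colouring, so any large reservoir element can be
added. -/
theorem IsCondition.exists_mem_ge {R : ℕ → ℕ → Prop} (hR : IsTournament R) {z : ℕ → ℕ}
    (hRz : OracleRE z fun x : ℕ × ℕ => R x.1 x.2) {𝒜 : Set (Set ℕ)} {σ : List Bool} {X : Set ℕ}
    {c : ℕ → ℕ} (hp : IsCondition R z 𝒜 σ X c) (m : ℕ) :
    ∃ τ X', IsCondition R z 𝒜 τ X' c ∧ IsExtension R σ X τ ∧ X' ⊆ X ∧ ∃ x ∈ supp τ, m ≤ x := by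
  obtain ⟨x, hxX, hx⟩ := hp.infinite.exists_gt (max m σ.length)
  have hm : m ≤ x := (le_max_left _ _).trans hx.le
  have hσ : σ.length ≤ x := (le_max_right _ _).trans hx.le
  let d : ℕ → Bool := fun i => if i < σ.length then σ.getD i false else decide (i = x)
  have hpre : σ <+: initSeg d (x + 1) := by
    have h1 : σ = initSeg d σ.length :=
      (initSeg_getD σ false).symm.trans (initSeg_congr fun i hi => by simp [d, hi])
    rw [h1]
    exact initSeg_prefix d (by omega)
  have hx_mem : x ∈ supp (initSeg d (x + 1)) := by
    change (initSeg d (x + 1)).getD x false = true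
    rw [getD_initSeg d (by omega)]
    simp [d, not_lt.2 hσ]
  have hnew : ∀ i ∈ newPart σ (initSeg d (x + 1)), i = x := by
    intro i hi
    obtain ⟨h1, h2⟩ := mem_newPart.1 hi
    have h3 : i < x + 1 := by simpa using lt_length_of_mem_supp h2
    have h2 : (initSeg d (x + 1)).getD i false = true := h2
    rw [getD_initSeg d h3] at h2
    simpa [d, not_lt.2 h1] using h2
  refine hp.exists_extension hR hRz (x + 1) fun g => ⟨initSeg d (x + 1), by simp,
    ⟨hpre, fun i hi => hnew i hi ▸ hxX, ?_⟩, ⟨g x, fun i hi => by rw [hnew i hi]⟩, x, hx_mem, hm⟩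
  intro i hi j hj k hk hij
  rw [hnew i hi, hnew j hj] at hij
  exact (hR.irrefl x hij).elim

/-- The set with characteristic function `y` satisfies the condition with finite part `supp σ` and
reservoir `X`. -/
structure Satisfies (R : ℕ → ℕ → Prop) (σ : List Bool) (X : Set ℕ) (y : ℕ → Bool) : Prop where
  eq_initSeg : σ = initSeg y σ.length
  subset : ∀ i, σ.length ≤ i → y i = true → i ∈ X
  transitive : IsTransitiveFor R {i | y i = true}

theorem mem_supp_initSeg {y : ℕ → Bool} {K i : ℕ} :
    i ∈ supp (initSeg y K) ↔ i < K ∧ y i = true := by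
  constructor
  · intro h
    have hi : i < K := by simpa using lt_length_of_mem_supp h
    have h : (initSeg y K).getD i false = true := h
    rw [getD_initSeg y hi] at h
    exact ⟨hi, h⟩
  · rintro ⟨hi, h⟩
    change (initSeg y K).getD i false = true
    rwa [getD_initSeg y hi]

theorem Satisfies.isExtension {R : ℕ → ℕ → Prop} {σ : List Bool} {X : Set ℕ} {y : ℕ → Bool}
    (h : Satisfies R σ X y) {K : ℕ} (hK : σ.length ≤ K) : IsExtension R σ X (initSeg y K) := by
  have hnew : ∀ i ∈ newPart σ (initSeg y K), σ.length ≤ i ∧ y i = true := fun i hi =>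
    ⟨(mem_newPart.1 hi).1, (mem_supp_initSeg.1 (mem_newPart.1 hi).2).2⟩
  refine ⟨?_, fun i hi => h.subset i (hnew i hi).1 (hnew i hi).2, fun i hi j hj k hk =>
    h.transitive i (hnew i hi).2 j (hnew j hj).2 k (hnew k hk).2⟩
  have := initSeg_prefix y hK
  rwa [← h.eq_initSeg] at this

/-- Every condition has an extension forcing that a given enumeration operator, applied to the
generic set joined with `z`, does not enumerate a given member of `𝒜`. -/
theorem IsCondition.exists_disagreement {R : ℕ → ℕ → Prop} (hR : IsTournament R) {z : ℕ → ℕ}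
    (hRz : OracleRE z fun x : ℕ × ℕ => R x.1 x.2) {𝒜 : Set (Set ℕ)} (h𝒜 : 𝒜.Countable)
    {σ : List Bool} {X : Set ℕ} {c : ℕ → ℕ} (hp : IsCondition R z 𝒜 σ X c) {A : Set ℕ}
    (hA : A ∈ 𝒜) {V : ℕ × List ℕ → Prop} (hV : PrimrecPred V) :
    ∃ τ X' c', IsCondition R z 𝒜 τ X' c' ∧ IsExtension R σ X τ ∧ X' ⊆ X ∧
      ∀ y, Satisfies R τ X' y → ¬ ∀ n, n ∈ A ↔ ∃ k, V (n, initSeg (oracleJoin z y) k) := by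
  have hRc : OracleRE c fun x : ℕ × ℕ => R x.1 x.2 := hRz.subst hp.graph
  -- The string `x.2` is a partial colouring. The length bound on `τ` ensures that every new point
  -- is coloured, so the default of `getD` plays no role.
  let U : ℕ × List Bool → Prop := fun x => ∃ τ : List Bool,
    (τ.length ≤ x.2.length ∧ ((∀ i ∈ newPart σ τ, x.2.getD i false = false) ∨
      ∀ i ∈ newPart σ τ, x.2.getD i false = true)) ∧ IsExtension R σ X τ ∧ Accepts z V x.1 τ
  have hU : OracleRE c U := by
    have hb : ∀ b, PrimrecPred fun x : (ℕ × List Bool) × List Bool =>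
        ∀ i ∈ newPart σ x.2, x.1.2.getD i false = b := fun b =>
      PrimrecPred.forall_mem (q := fun x : ((ℕ × List Bool) × List Bool) × ℕ =>
        x.1.1.2.getD x.2 false = b) (Primrec.eq.comp ((Primrec.list_getD false).comp
          (Primrec.snd.comp (Primrec.fst.comp Primrec.fst)) Primrec.snd) (Primrec.const b))
        ((primrec_newPart σ).comp Primrec.snd)
    have hl : PrimrecPred fun x : (ℕ × List Bool) × List Bool => x.2.length ≤ x.1.2.length :=
      Primrec.nat_le.comp (Primrec.list_length.comp Primrec.snd)
        (Primrec.list_length.comp (Primrec.snd.comp Primrec.fst))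
    refine OracleRE.exists_of (q := fun x : (ℕ × List Bool) × List Bool =>
      (x.2.length ≤ x.1.2.length ∧ ((∀ i ∈ newPart σ x.2, x.1.2.getD i false = false) ∨
        ∀ i ∈ newPart σ x.2, x.1.2.getD i false = true)) ∧ IsExtension R σ X x.2 ∧
        Accepts z V x.1.1 x.2) ?_
    exact (OracleRE.of_primrec (hl.and ((hb false).or (hb true)))).and
      (((oracleRE_isExtension hR hRc hp.oracleRE σ).comp Primrec.snd).and
        (((oracleRE_accepts hV).subst hp.graph).comp
          ((Primrec.fst.comp Primrec.fst).pair Primrec.snd)))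
  obtain ⟨n, ⟨hn, hnA⟩ | ⟨hnA, hn⟩⟩ :=
    DefStrength.exists_disagreement (hp.avoids A hA) hU.forall_cantor
  · obtain ⟨N, hN⟩ := exists_uniform_bar (U := fun l => U (n, l)) hn
    obtain ⟨τ, X', hq, hτ, hX', hacc⟩ := hp.exists_extension hR hRz N
      (Q := fun τ => Accepts z V n τ) fun g => by
        obtain ⟨k, hk, τ, ⟨hlen, hhom⟩, hτ, hacc⟩ := hN g
        simp only [length_initSeg] at hlen
        have hg : ∀ i ∈ newPart σ τ, (initSeg g k).getD i false = g i := fun i hi =>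
          getD_initSeg g ((lt_length_of_mem_supp (mem_newPart.1 hi).2).trans_le hlen) _
        refine ⟨τ, hlen.trans hk, hτ, ?_, hacc⟩
        rcases hhom with h | h
        · exact ⟨false, fun i hi => (hg i hi).symm.trans (h i hi)⟩
        · exact ⟨true, fun i hi => (hg i hi).symm.trans (h i hi)⟩
    refine ⟨τ, X', c, hq, hτ, hX', fun y hy h => hnA ((h n).2 ?_)⟩
    rw [hy.eq_initSeg] at hacc
    obtain ⟨j, -, hj⟩ := accepts_initSeg.1 hacc
    exact ⟨j, hj⟩
  · push Not at hn
    -- `g` is a colouring with no homogeneous extension accepting `n`. Avoidance for `c` joined with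
    -- `g` allows the reservoir to be restricted to a colour class of `g`.
    obtain ⟨g, hg, hav⟩ := exists_path_avoiding h𝒜 hp.avoids
      (T := fun l => U (n, l)) (hU.comp ((Primrec.const n).pair Primrec.id)) hn
    have hinf : ∃ b, (X ∩ {x | g x = b}).Infinite := by
      by_contra! h
      refine hp.infinite (((h true).union (h false)).subset fun x hx => ?_)
      cases hgx : g x
      · exact .inr ⟨hx, hgx⟩
      · exact .inl ⟨hx, hgx⟩
    obtain ⟨b, hb⟩ := hinf
    have hcg := oracleRE_graph_oracleJoin_left c g
    refine ⟨σ, X ∩ {x | g x = b}, oracleJoin c g,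
      ⟨hb, (hp.oracleRE.subst hcg).and (oracleRE_oracleJoin_right c g b), hp.graph.subst hcg, hav,
        fun x hx => hp.transitive x hx.1, fun a ha => (hp.uniform a ha).imp
        (fun h x hx => h x hx.1) fun h x hx => h x hx.1⟩, ?_, fun x hx => hx.1, fun y hy h => ?_⟩
    · have : newPart σ σ = [] := List.eq_nil_iff_forall_not_mem.2 fun i hi => by
        have := mem_newPart.1 hi
        exact absurd (lt_length_of_mem_supp this.2) (by omega)
      exact ⟨List.prefix_rfl, by simp [this], by simp [this]⟩
    · obtain ⟨k, hk⟩ := (h n).1 hnA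
      have hext := hy.isExtension (le_max_right k σ.length)
      have hhom : ∀ i ∈ newPart σ (initSeg y (max k σ.length)),
          (initSeg g (max k σ.length)).getD i false = b := fun i hi => by
        have hi' : i < max k σ.length := by
          simpa only [length_initSeg] using lt_length_of_mem_supp (mem_newPart.1 hi).2
        rw [getD_initSeg g hi']
        exact (hext.subset i hi).2
      -- If `y` accepted `n`, an initial segment long enough to contain both the use and `σ` would
      -- be a homogeneous accepting extension, contrary to the choice of `g`.
      refine hg (max k σ.length) ⟨initSeg y (max k σ.length), ⟨by simp, ?_⟩,
        ⟨hext.isPrefix, fun i hi => (hext.subset i hi).1, hext.transitive⟩,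
        accepts_initSeg.2 ⟨k, le_max_left _ _, hk⟩⟩
      cases b
      · exact .inl hhom
      · exact .inr hhom

/-- Every tournament computable in `z` has an infinite transitive set that, joined with `z`, does
not enumerate any of countably many sets that `z` does not enumerate. -/
theorem exists_infinite_transitive_avoiding {R : ℕ → ℕ → Prop} (hR : IsTournament R) {z : ℕ → ℕ}
    (hRz : OracleRE z fun x : ℕ × ℕ => R x.1 x.2) {𝒜 : Set (Set ℕ)} (h𝒜 : 𝒜.Countable)
    (hz : ∀ A ∈ 𝒜, ¬ OracleRE z (· ∈ A)) :
    ∃ y : ℕ → Bool, {i | y i = true}.Infinite ∧ IsTransitiveFor R {i | y i = true} ∧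
      ∀ A ∈ 𝒜, ¬ OracleRE (oracleJoin z y) (· ∈ A) := by
  classical
  have : Countable 𝒜 := h𝒜
  have : Countable {V : ℕ × List ℕ → Prop // PrimrecPred V} := countable_primrecPred
  let P := {p : List Bool × Set ℕ × (ℕ → ℕ) // IsCondition R z 𝒜 p.1 p.2.1 p.2.2}
  let r : P → P → Prop := fun p q =>
    p.1.1 <+: q.1.1 ∧ (∀ i ∈ newPart p.1.1 q.1.1, i ∈ p.1.2.1) ∧ q.1.2.1 ⊆ p.1.2.1
  have hrefl : ∀ p, r p p := fun p => ⟨List.prefix_rfl, fun i hi => by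
    have := mem_newPart.1 hi
    exact absurd (lt_length_of_mem_supp this.2) (by omega), subset_rfl⟩
  have htrans : ∀ p q s, r p q → r q s → r p s := by
    rintro p q s ⟨h1, h2, h3⟩ ⟨h1', h2', h3'⟩
    refine ⟨h1.trans h1', fun i hi => ?_, h3'.trans h3⟩
    obtain ⟨hi1, hi2⟩ := mem_newPart.1 hi
    rcases lt_or_ge i q.1.1.length with h | h
    · exact h2 i (mem_newPart.2 ⟨hi1, (mem_supp_of_prefix h1' h).1 hi2⟩)
    · exact h3 (h2' i (mem_newPart.2 ⟨h, hi2⟩))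
  let D : ℕ ⊕ (𝒜 × {V : ℕ × List ℕ → Prop // PrimrecPred V}) → P → Prop := fun i p =>
    i.elim (fun m => ∃ x ∈ supp p.1.1, m ≤ x) fun i => ∀ y, Satisfies R p.1.1 p.1.2.1 y →
      ¬ ∀ n, n ∈ i.1.1 ↔ ∃ k, i.2.1 (n, initSeg (oracleJoin z y) k)
  have hD : ∀ i p, ∃ q, r p q ∧ D i q := by
    rintro (m | ⟨⟨A, hA⟩, ⟨V, hV⟩⟩) ⟨⟨σ, X, c⟩, hp⟩
    · obtain ⟨τ, X', hq, hτ, hX', h⟩ := hp.exists_mem_ge hR hRz m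
      exact ⟨⟨⟨τ, X', c⟩, hq⟩, ⟨hτ.isPrefix, hτ.subset, hX'⟩, h⟩
    · obtain ⟨τ, X', c', hq, hτ, hX', h⟩ := hp.exists_disagreement hR hRz h𝒜 hA hV
      exact ⟨⟨⟨τ, X', c'⟩, hq⟩, ⟨hτ.isPrefix, hτ.subset, hX'⟩, h⟩
  have h0 : IsCondition R z 𝒜 [] Set.univ z := by
    have hemp : ∀ i, i ∉ supp [] := fun i hi => by simpa using lt_length_of_mem_supp hi
    refine ⟨Set.infinite_univ, ?_, OracleRE.graph z, hz, ?_, fun a ha => (hemp a ha).elim⟩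
    · exact (OracleRE.of_primrec (Primrec.eq.comp Primrec.id Primrec.id)).of_iff fun n => by simp
    · rintro x - a (rfl | ha) b (rfl | hb) d (rfl | hd) h1 h2
      · exact h1
      all_goals first
        | exact (hemp _ ha).elim
        | exact (hemp _ hb).elim
        | exact (hemp _ hd).elim
  obtain ⟨s, -, hs, hsD⟩ := exists_generic_sequence hrefl htrans hD ⟨⟨[], Set.univ, z⟩, h0⟩
  let Y : Set ℕ := {i | ∃ n, i ∈ supp (s n).1.1}
  have hmono : ∀ m n, m ≤ n → supp (s m).1.1 ⊆ supp (s n).1.1 := fun m n hmn i hi =>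
    (mem_supp_of_prefix (hs m n hmn).1 (lt_length_of_mem_supp hi)).2 hi
  have hY : ∀ n i, i < (s n).1.1.length → i ∈ Y → i ∈ supp (s n).1.1 := by
    rintro n i hi ⟨m, hm⟩
    rcases le_total m n with h | h
    · exact hmono m n h hm
    · exact (mem_supp_of_prefix (hs n m h).1 hi).1 hm
  let y : ℕ → Bool := fun i => decide (i ∈ Y)
  have hyY : ∀ i, y i = true ↔ i ∈ Y := fun i => by simp [y]
  have hyset : {i | y i = true} = Y := Set.ext hyY
  have htr : IsTransitiveFor R Y := by
    rintro a ⟨i, ha⟩ b ⟨j, hb⟩ d ⟨k, hd⟩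
    let n := max i (max j k)
    obtain ⟨x, hx⟩ := (s n).2.infinite.nonempty
    have h := (s n).2.transitive x hx
    exact h a (.inr (hmono i n (by omega) ha)) b (.inr (hmono j n (by omega) hb)) d
      (.inr (hmono k n (by omega) hd))
  -- The generic set satisfies every condition in the sequence, so everything forced along the way
  -- holds of it.
  have hsat : ∀ n, Satisfies R (s n).1.1 (s n).1.2.1 y := by
    intro n
    refine ⟨?_, fun i hi hiy => ?_, hyset ▸ htr⟩
    · refine (initSeg_getD (s n).1.1 false).symm.trans (initSeg_congr fun i hi => ?_)
      rw [Bool.eq_iff_iff, hyY]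
      exact ⟨fun h => ⟨n, h⟩, hY n i hi⟩
    · obtain ⟨m, hm⟩ := (hyY i).1 hiy
      rcases le_total m n with h | h
      · exact absurd (lt_length_of_mem_supp (hmono m n h hm)) (not_lt.2 hi)
      · exact (hs n m h).2.1 i (mem_newPart.2 ⟨hi, hm⟩)
  refine ⟨y, hyset ▸ Set.infinite_of_forall_exists_gt fun m => ?_, hyset ▸ htr, fun A hA ⟨V, hV, h⟩ => ?_⟩
  · obtain ⟨n, x, hx, hm⟩ := hsD (.inl (m + 1))
    exact ⟨x, ⟨n, hx⟩, hm⟩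
  · obtain ⟨n, hn⟩ := hsD (.inr (⟨A, hA⟩, ⟨V, hV⟩))
    exact hn y (hsat n) h

/-! ### Transfer to joins of sets and to `Δ⁰₂`-definitions -/

theorem oracleRE_graph_chi_setJoin (Z Y : Set ℕ) {y : ℕ → Bool} (hy : ∀ i, y i = true ↔ i ∈ Y) :
    OracleRE (oracleJoin (chi Z) y) fun x : ℕ × ℕ => chi (setJoin Z Y) x.1 = x.2 := by
  have hval : ∀ n, chi (setJoin Z Y) n = if n % 2 = 0 then (oracleJoin (chi Z) y (n / 2)).unpair.1
      else (oracleJoin (chi Z) y (n / 2)).unpair.2 := by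
    intro n
    have hmem : n ∈ setJoin Z Y ↔ (n % 2 = 0 ∧ n / 2 ∈ Z) ∨ (n % 2 ≠ 0 ∧ n / 2 ∈ Y) := by
      constructor
      · rintro (⟨m, hm, rfl⟩ | ⟨m, hm, rfl⟩)
        · exact .inl ⟨by omega, by rwa [Nat.mul_div_cancel_left _ (by norm_num)]⟩
        · exact .inr ⟨by omega, by rwa [show (2 * m + 1) / 2 = m by omega]⟩
      · rintro (⟨h1, h2⟩ | ⟨h1, h2⟩)
        · exact .inl ⟨_, h2, by omega⟩
        · exact .inr ⟨_, h2, by omega⟩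
    by_cases h : n % 2 = 0
    · by_cases h' : n / 2 ∈ Z <;> simp [chi, oracleJoin, hmem, h, h']
    · by_cases h' : n / 2 ∈ Y
      · simp [chi, oracleJoin, hmem, h, h', (hy _).2 h']
      · have : y (n / 2) = false := Bool.eq_false_iff.2 (mt (hy (n / 2)).1 h')
        simp [chi, oracleJoin, hmem, h, h', this]
  refine (OracleRE.exists_of (q := fun w : (ℕ × ℕ) × ℕ =>
    oracleJoin (chi Z) y (w.1.1 / 2) = w.2 ∧
      (if w.1.1 % 2 = 0 then w.2.unpair.1 else w.2.unpair.2) = w.1.2)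
    (((OracleRE.graph _).comp (f := fun w : (ℕ × ℕ) × ℕ => (w.1.1 / 2, w.2)) ?_).and
      (OracleRE.of_primrec ?_))).of_iff fun x => ?_
  · exact (Primrec.nat_div.comp (Primrec.fst.comp Primrec.fst) (Primrec.const 2)).pair Primrec.snd
  · refine Primrec.eq.comp (Primrec.ite ?_ ?_ ?_) (Primrec.snd.comp Primrec.fst)
    · exact Primrec.eq.comp (Primrec.nat_mod.comp (Primrec.fst.comp Primrec.fst)
        (Primrec.const 2)) (Primrec.const 0)
    · exact Primrec.fst.comp (Primrec.unpair.comp Primrec.snd)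
    · exact Primrec.snd.comp (Primrec.unpair.comp Primrec.snd)
  · simp [hval]

/-- Preservation of `Δ⁰₂`-definitions follows from not enumerating the `Σ⁰₂` sets, relative to the
ground oracle, that the ground oracle does not enumerate. -/
theorem preservesDeltaSuccDefinitions_one {Z Y : Set ℕ}
    (h : ∀ A, IsSigmaIn Z 2 A → ¬ IsSigmaIn Z 1 A →
      ¬ IsSigmaIn (setJoin Z Y) 1 A) : PreservesDeltaSuccDefinitions 1 Y Z := by
  rintro A ⟨⟨h1, h2⟩, h3, h4⟩
  have hZ := setTuringReducible_setJoin_left Z Y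
  exact ⟨⟨isSigmaIn_mono hZ h1, isSigmaIn_mono hZ h2⟩, h A h1 h3, h Aᶜ h2 h4⟩

end DefStrength

theorem mainTheorem3 :
    DefStrength.AdmitsPreservationOfDeltaSuccDefinitions 1 DefStrength.EM := by
  open DefStrength in
  intro Z X hXZ
  -- When `X` codes no tournament, `EM` is vacuous but preservation is still demanded; the usual
  -- order then serves as a substitute tournament.
  obtain ⟨R, hR, hRZ, hRX⟩ : ∃ R : ℕ → ℕ → Prop, IsTournament R ∧
      (OracleRE (chi Z) fun x : ℕ × ℕ => R x.1 x.2) ∧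
      (IsTournament (codedRel X) → R = codedRel X) := by
    by_cases hX : IsTournament (codedRel X)
    · refine ⟨_, hX, ?_, fun _ => rfl⟩
      exact ((oracleRE_chi_mem X).subst (oracleRE_graph_of_reducible hXZ)).comp
        (Primrec₂.natPair.comp Primrec.fst Primrec.snd)
    · exact ⟨(· < ·), ⟨fun _ _ => 1, by simp⟩, OracleRE.of_primrec Primrec.nat_lt,
        fun h => (hX h).elim⟩
  have hcount : {A | IsSigmaIn Z 2 A ∧ ¬ OracleRE (chi Z) (· ∈ A)}.Countable :=
    (countable_isSigmaIn Z 2).mono fun A hA => hA.1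
  obtain ⟨y, hinf, htr, hy⟩ := exists_infinite_transitive_avoiding hR hRZ hcount fun A hA => hA.2
  refine ⟨{i | y i = true}, preservesDeltaSuccDefinitions_one fun A hA hA1 hA2 => ?_,
    fun h => ⟨hinf, hRX h ▸ htr⟩⟩
  exact hy A ⟨hA, mt isSigmaIn_of_oracleRE hA1⟩ ((oracleRE_of_isSigmaIn hA2).subst
    (oracleRE_graph_chi_setJoin Z _ fun i => Iff.rfl))
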